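/- Fix $d\in\mathbb{N}$ and an infinite-dimensional complex Hilbert space $H$. Let $\mathcal{P}_d=\bigoplus_{k\ge 0}\mathcal{P}_d^k$ be the free unital complex algebra on $d$ generators $s_1,\dots,s_d$, graded by word length. Let $\mathcal{F}(\mathbb{C}^d)=\bigoplus_{k\ge0}(\mathbb{C}^d)^{\otimes k}$ (Hilbert direct sum) be the full Fock space and $Ev:\mathcal{P}_d\to\mathcal{F}(\mathbb{C}^d)$ the linear map $s_{i_1}\cdots s_{i_k}\mapsto e_{i_1}\otimes\cdots\otimes e_{i_k}$. For a two-sided graded ideal $I=\bigoplus_{k\ge1}I^k\subset\mathcal{P}_d$, $I^k=I\cap\mathcal{P}_d^k$, let $p_I$ be the orthogonal projection of $\mathcal{F}(\mathbb{C}^d)$ onto $Ev(I)^\perp$, and let $\mathcal{M}$ be the set of all operators $p_I$ with the topology induced by the strong operator topology on $\mathcal{B}(\mathcal{F}(\mathbb{C}^d))$. For $x>0$ let $[\mathcal{B}(H)^d]_x=\{(T_1,\dots,T_d)\in\mathcal{B}(H)^d:\|T_1T_1^*+\dots+T_dT_d^*\|<x^2\}$. Let $\mathcal{F}_d$ be the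 algebra of formal free series $F=\sum_\alpha a_\alpha z_\alpha$ in noncommuting variables $z_1,\dots,z_d$ with $\sum_{k\ge0}\|F_k(T)\|<\infty$ for all $T\in[\mathcal{B}(H)^d]_1$, where $F_k(T)=\sum_{|\alpha|=k}a_\alpha T_\alpha$, with the locally convex topology given by the seminorms $\|F\|_x=\sup\{\|\sum_kF_k(T)\|:T\in[\mathcal{B}(H)^d]_x\}$, $0<x<1$. Regard $\mathcal{P}_d$ as a subalgebra of $\mathcal{F}_d$ via $s_i\mapsto z_i$, let $\overline{I}$ be the closure of $I$ in $\mathcal{F}_d$, and write $\|\cdot\|_x$ also for the quotient seminorm $q\mapsto\inf\{\|F\|_x:F\in\mathcal{F}_d,\ F+\overline I=q\}$ on $\mathcal{F}_d/\overline{I}$. A bundle of locally convex algebras $(E,X,\pi,\mathcal{N})$ consists of topological spaces $E,X$, a continuous open surjection $\pi:E\to X$, a unital complex algebra structure on each fiber $\pi^{-1}(x)$, and a set $\mathcal{N}$ of functions $E\to\mathbb{R}_{\ge0}$, each restricting to a seminorm on every fiber, such that: for all $\sigma_1,\sigma_2\in\mathcal{N}$ there are $\sigma\in\mathcal{N}$,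 $C>0$ with $\sigma_1,\sigma_2\le C\sigma$ on $E$; fiberwise addition and multiplication $E\times_XE\to E$ and scalar multiplication $E\times\mathbb{C}\to E$ are continuous; for each $x\in X$ the sets $\{e:\pi(e)\in U,\ \sigma(e)<\varepsilon\}$ ($U$ an open neighborhood of $x$, $\sigma\in\mathcal{N}$, $\varepsilon>0$) form a local base at the zero of $\pi^{-1}(x)$; every $\sigma\in\mathcal{N}$ is continuous. **Theorem.** Let $(E,X,\pi,\mathcal{N})$ be a bundle of locally convex algebras, let $I_x\subset\mathcal{P}_d$ ($x\in X$) be two-sided graded ideals as above, and let $\Psi_x:\mathcal{F}_d/\overline{I_x}\to\pi^{-1}(x)$ be isomorphisms of topological algebras, where $\pi^{-1}(x)$ carries the topology induced from $E$. Suppose that for each $i=1,\dots,d$ the section $X\to E$, $x\mapsto\Psi_x(z_i+\overline{I_x})$, is continuous, and that for some $r\in(0,1)$ the function $E\to\mathbb{R}_{\ge0}$, $e\mapsto\|\Psi_{\pi(e)}^{-1}(e)\|_r$, is continuous. Then the map $X\to\mathcal{M}$, $x\mapsto p_{I_x}$, is continuous. -/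

import Mathlib

namespace FreeHol

/-- Words in `d` letters: the free unital semigroup on `d` generators. -/
abbrev Word (d : ℕ) : Type := FreeMonoid (Fin d)

/-- Formal free series `∑ a_α z_α` in `d` noncommuting variables, given by their coefficients. -/
@[ext] structure FreeSeries (d : ℕ) where
  coeff : Word d → ℂ

namespace FreeSeries

variable {d : ℕ}

instance : Zero (FreeSeries d) := ⟨⟨fun _ => 0⟩⟩
instance : Add (FreeSeries d) := ⟨fun F G => ⟨fun w => F.coeff w + G.coeff w⟩⟩
instance : Neg (FreeSeries d) := ⟨fun F => ⟨fun w => -F.coeff w⟩⟩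
instance : Sub (FreeSeries d) := ⟨fun F G => ⟨fun w => F.coeff w - G.coeff w⟩⟩
instance {S : Type*} [SMul S ℂ] : SMul S (FreeSeries d) := ⟨fun c F => ⟨fun w => c • F.coeff w⟩⟩
instance : One (FreeSeries d) := ⟨⟨fun w => if w.toList = [] then 1 else 0⟩⟩

/-- The product of formal free series: the coefficient of the product at the word `w` is the sum
of `F_u G_v` over all factorizations `w = u v`, that is over all cuts of the word `w`. -/
instance : Mul (FreeSeries d) := ⟨fun F G => ⟨fun w =>
  ∑ i ∈ Finset.range (w.toList.length + 1),
    F.coeff (FreeMonoid.ofList (w.toList.take i)) * G.coeff (FreeMonoid.ofList (w.toList.drop i))⟩⟩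

@[simp] lemma coeff_zero (w : Word d) : (0 : FreeSeries d).coeff w = 0 := rfl
@[simp] lemma coeff_add (F G : FreeSeries d) (w : Word d) :
    (F + G).coeff w = F.coeff w + G.coeff w := rfl
@[simp] lemma coeff_neg (F : FreeSeries d) (w : Word d) : (-F).coeff w = -F.coeff w := rfl
@[simp] lemma coeff_sub (F G : FreeSeries d) (w : Word d) :
    (F - G).coeff w = F.coeff w - G.coeff w := rfl
@[simp] lemma coeff_smul {S : Type*} [SMul S ℂ] (c : S) (F : FreeSeries d) (w : Word d) :
    (c • F).coeff w = c • F.coeff w := rfl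
lemma coeff_one (w : Word d) : (1 : FreeSeries d).coeff w = if w.toList = [] then 1 else 0 := rfl
lemma coeff_mul (F G : FreeSeries d) (w : Word d) : (F * G).coeff w =
    ∑ i ∈ Finset.range (w.toList.length + 1), F.coeff (FreeMonoid.ofList (w.toList.take i)) *
      G.coeff (FreeMonoid.ofList (w.toList.drop i)) := rfl

lemma coeff_injective : Function.Injective (coeff : FreeSeries d → Word d → ℂ) :=
  fun _ _ h => FreeSeries.ext h

instance : AddCommGroup (FreeSeries d) :=
  coeff_injective.addCommGroup _ rfl (fun _ _ => rfl) (fun _ => rfl) (fun _ _ => rfl)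
    (fun _ _ => rfl) (fun _ _ => rfl)

lemma mul_assoc_aux (f g h : List (Fin d) → ℂ) (w : List (Fin d)) :
    ∑ i ∈ Finset.range (w.length + 1),
      (∑ j ∈ Finset.range ((w.take i).length + 1), f ((w.take i).take j) * g ((w.take i).drop j))
        * h (w.drop i) =
    ∑ i ∈ Finset.range (w.length + 1), f (w.take i) *
      ∑ j ∈ Finset.range ((w.drop i).length + 1),
        g ((w.drop i).take j) * h ((w.drop i).drop j) := by
  induction w generalizing f with
  | nil => simp [mul_assoc]
  | cons a w ih =>
    rw [List.length_cons]
    conv_lhs => rw [Finset.sum_range_succ']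
    conv_rhs => rw [Finset.sum_range_succ']
    have := ih (fun l => f (a :: l))
    simp only [List.take_succ_cons, List.drop_succ_cons, List.take_zero, List.drop_zero,
      List.length_cons, List.length_nil] at this ⊢
    rw [← this]
    simp only [Finset.sum_range_succ' _ (_ + 1)]
    simp [Finset.sum_range_succ', add_mul, mul_add, Finset.sum_add_distrib, mul_assoc,
      Finset.mul_sum]
    ring

instance : Ring (FreeSeries d) where
  mul_assoc F G H := by
    ext w
    exact mul_assoc_aux (fun l => F.coeff (FreeMonoid.ofList l))
      (fun l => G.coeff (FreeMonoid.ofList l)) (fun l => H.coeff (FreeMonoid.ofList l)) w.toList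
  one_mul F := by
    ext w
    rw [coeff_mul, Finset.sum_range_succ', Finset.sum_eq_zero]
    · simp [coeff_one]
    · intro i hi
      have : w.toList ≠ [] := by rintro h; simp [h] at hi
      simp [coeff_one, this]
  mul_one F := by
    ext w
    rw [coeff_mul, Finset.sum_range_succ, Finset.sum_eq_zero]
    · simp [coeff_one]
    · intro i hi
      simp only [Finset.mem_range] at hi
      rw [coeff_one, if_neg (by simpa using hi), mul_zero]
  zero_mul F := by ext w; simp [coeff_mul]
  mul_zero F := by ext w; simp [coeff_mul]
  left_distrib F G H := by ext w; simp [coeff_mul, mul_add, Finset.sum_add_distrib]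
  right_distrib F G H := by ext w; simp [coeff_mul, add_mul, Finset.sum_add_distrib]
  neg_add_cancel := neg_add_cancel
  sub_eq_add_neg := sub_eq_add_neg
  zsmul := (· • ·)
  zsmul_zero' := SubNegMonoid.zsmul_zero'
  zsmul_succ' := SubNegMonoid.zsmul_succ'
  zsmul_neg' := SubNegMonoid.zsmul_neg'

instance : Module ℂ (FreeSeries d) where
  one_smul F := by ext w; simp
  mul_smul a b F := by ext w; simp [mul_assoc]
  smul_zero a := by ext w; simp
  smul_add a F G := by ext w; simp [mul_add]
  add_smul a b F := by ext w; simp [add_mul]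
  zero_smul F := by ext w; simp

instance : Algebra ℂ (FreeSeries d) := Algebra.ofModule
  (fun c F G => by ext w; simp [coeff_mul, Finset.mul_sum, mul_assoc])
  (fun c F G => by ext w; simp [coeff_mul, Finset.mul_sum, mul_left_comm])

/-- The variable `z_i` as a formal free series. -/
def Z (i : Fin d) : FreeSeries d := ⟨fun w => if w.toList = [i] then 1 else 0⟩

end FreeSeries

lemma finite_words (d k : ℕ) : {w : Word d | w.toList.length = k}.Finite :=
  List.finite_length_eq (Fin d) k

/-- The finite set of words of length `k` in `d` letters. -/
noncomputable def words (d k : ℕ) : Finset (Word d) :=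
  (finite_words d k).toFinset

lemma mem_words {d k : ℕ} {w : Word d} : w ∈ words d k ↔ w.toList.length = k := by
  simp [words]

section Operators

variable {H : Type*} [NormedAddCommGroup H] [InnerProductSpace ℂ H] {d : ℕ}

/-- `T_w = T_{i_1} ⋯ T_{i_k}` for a word `w = g_{i_1} ⋯ g_{i_k}`. -/
noncomputable def wordProd (T : Fin d → H →L[ℂ] H) (w : Word d) : H →L[ℂ] H :=
  (w.toList.map T).prod

/-- `F_k(T_1, …, T_d)`, the value at `T` of the homogeneous component of degree `k` of `F`. -/
noncomputable def evalHom (F : FreeSeries d) (k : ℕ) (T : Fin d → H →L[ℂ] H) : H →L[ℂ] H :=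
  ∑ w ∈ words d k, F.coeff w • wordProd T w

/-- The open operator ball of radius `x` in `B(H)^d`. -/
def opBall (H : Type*) [NormedAddCommGroup H] [InnerProductSpace ℂ H] [CompleteSpace H]
    (d : ℕ) (x : ℝ) : Set (Fin d → H →L[ℂ] H) :=
  {T | ‖∑ i, T i * ContinuousLinearMap.adjoint (T i)‖ < x ^ 2}

lemma evalHom_add (F G : FreeSeries d) (k : ℕ) (T : Fin d → H →L[ℂ] H) :
    evalHom (F + G) k T = evalHom F k T + evalHom G k T := by
  simp [evalHom, add_smul, Finset.sum_add_distrib]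

lemma evalHom_smul (c : ℂ) (F : FreeSeries d) (k : ℕ) (T : Fin d → H →L[ℂ] H) :
    evalHom (c • F) k T = c • evalHom F k T := by
  simp [evalHom, Finset.smul_sum, mul_smul]

lemma evalHom_mul (F G : FreeSeries d) (k : ℕ) (T : Fin d → H →L[ℂ] H) :
    evalHom (F * G) k T = ∑ ij ∈ Finset.HasAntidiagonal.antidiagonal k, evalHom F ij.1 T * evalHom G ij.2 T := by
  have h1 : evalHom (F * G) k T = ∑ i ∈ Finset.range (k + 1), ∑ w ∈ words d k,
      (F.coeff (FreeMonoid.ofList (w.toList.take i)) *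
        G.coeff (FreeMonoid.ofList (w.toList.drop i))) • wordProd T w := by
    rw [Finset.sum_comm]
    refine Finset.sum_congr rfl fun w hw => ?_
    rw [FreeSeries.coeff_mul, mem_words.1 hw, Finset.sum_smul]
  rw [h1, Finset.Nat.sum_antidiagonal_eq_sum_range_succ
    (fun i j => evalHom F i T * evalHom G j T)]
  refine Finset.sum_congr rfl fun i hi => ?_
  have hi : i ≤ k := by simpa [Nat.lt_succ_iff] using hi
  rw [evalHom, evalHom, Finset.sum_mul_sum, ← Finset.sum_product']
  refine Finset.sum_nbij' (fun w => (FreeMonoid.ofList (w.toList.take i),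
    FreeMonoid.ofList (w.toList.drop i))) (fun p => p.1 * p.2) ?_ ?_ ?_ ?_ ?_
  · intro w hw
    have := mem_words.1 hw
    simp [mem_words, this, hi]
  · intro p hp
    simp only [Finset.mem_product, mem_words] at hp
    simp [mem_words, hp.1, hp.2, hi]
  · intro w _
    exact FreeMonoid.toList.injective (by simp)
  · intro p hp
    simp only [Finset.mem_product, mem_words] at hp
    ext1
    · exact FreeMonoid.toList.injective (by simp [← hp.1])
    · exact FreeMonoid.toList.injective (by simp [← hp.1])
  · intro w _
    simp only [smul_mul_smul_comm]
    congr 1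
    simp only [wordProd, FreeMonoid.toList_ofList, ← List.prod_append, ← List.map_append,
      List.take_append_drop]

lemma sum_words_zero {M : Type*} [AddCommMonoid M] (f : Word d → M) :
    ∑ w ∈ words d 0, f w = f 1 := by
  have : words d 0 = {1} := by
    ext w
    simp only [mem_words, List.length_eq_zero_iff, Finset.mem_singleton]
    exact FreeMonoid.toList.injective.eq_iff (a := w) (b := 1)
  rw [this, Finset.sum_singleton]

lemma sum_words_succ {M : Type*} [AddCommMonoid M] (k : ℕ) (f : Word d → M) :
    ∑ w ∈ words d (k + 1), f w = ∑ a, ∑ w ∈ words d k, f (FreeMonoid.of a * w) := by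
  rw [← Finset.sum_product']
  symm
  refine Finset.sum_bij (fun p _ => FreeMonoid.of p.1 * p.2) ?_ ?_ ?_ ?_
  · intro p hp
    simp only [Finset.mem_product, mem_words] at hp
    simp [mem_words, hp.2]
  · intro p _ q _ h
    have h' := congrArg FreeMonoid.toList h
    simp only [FreeMonoid.toList_mul, FreeMonoid.toList_of, List.singleton_append,
      List.cons.injEq] at h'
    exact Prod.ext h'.1 (FreeMonoid.toList.injective h'.2)
  · intro w hw
    have hw := mem_words.1 hw
    obtain ⟨a, l, hl⟩ := List.exists_cons_of_length_eq_add_one hw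
    refine ⟨(a, FreeMonoid.ofList l), ?_, ?_⟩
    · simp only [Finset.mem_product, Finset.mem_univ, true_and, mem_words]
      simpa [hl] using hw
    · exact FreeMonoid.toList.injective (by simp [hl])
  · intro p _
    rfl

lemma wordProd_one (T : Fin d → H →L[ℂ] H) : wordProd T 1 = 1 := by simp [wordProd]

lemma wordProd_cons (T : Fin d → H →L[ℂ] H) (a : Fin d) (w : Word d) :
    wordProd T (FreeMonoid.of a * w) = T a * wordProd T w := by simp [wordProd]

/-- The `ℓ²`-norm of the coefficients of degree `k`. -/
noncomputable def l2 (F : FreeSeries d) (k : ℕ) : ℝ := √(∑ w ∈ words d k, ‖F.coeff w‖ ^ 2)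

lemma l2_nonneg (F : FreeSeries d) (k : ℕ) : 0 ≤ l2 F k := Real.sqrt_nonneg _

lemma norm_sq_sum_isometry (V : Fin d → H →ₗᵢ[ℂ] H) (hV : OrthogonalFamily ℂ (fun _ => H) V)
    (k : ℕ) (c : Word d → ℂ) (v : H) :
    ‖∑ w ∈ words d k, c w • wordProd (fun i => (V i).toContinuousLinearMap) w v‖ ^ 2 =
      (∑ w ∈ words d k, ‖c w‖ ^ 2) * ‖v‖ ^ 2 := by
  induction k generalizing c with
  | zero => simp [sum_words_zero, wordProd_one, norm_smul, mul_pow]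
  | succ k ih =>
    rw [sum_words_succ, sum_words_succ]
    have : ∀ a : Fin d, ∑ w ∈ words d k, c (FreeMonoid.of a * w) •
        wordProd (fun i => (V i).toContinuousLinearMap) (FreeMonoid.of a * w) v =
        V a (∑ w ∈ words d k, c (FreeMonoid.of a * w) •
          wordProd (fun i => (V i).toContinuousLinearMap) w v) := by
      intro a
      simp [wordProd_cons, map_sum]
    simp only [this]
    rw [hV.norm_sum, Finset.sum_mul]
    exact Finset.sum_congr rfl fun a _ => ih _

lemma evalHom_smul_arg (F : FreeSeries d) (k : ℕ) (y : ℂ) (T : Fin d → H →L[ℂ] H) :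
    evalHom F k (fun i => y • T i) = y ^ k • evalHom F k T := by
  have hw : ∀ l : List (Fin d), (l.map (fun i => y • T i)).prod = y ^ l.length • (l.map T).prod := by
    intro l
    induction l with
    | nil => simp
    | cons a l ih => rw [List.map_cons, List.prod_cons, ih, smul_mul_smul_comm, List.map_cons,
        List.prod_cons, List.length_cons, pow_succ']
  rw [evalHom, evalHom, Finset.smul_sum]
  refine Finset.sum_congr rfl fun w h => ?_
  rw [wordProd, hw, mem_words.1 h, smul_comm]
  rfl

lemma l2_le_norm_evalHom [Nontrivial H] (V : Fin d → H →ₗᵢ[ℂ] H)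
    (hV : OrthogonalFamily ℂ (fun _ => H) V) (F : FreeSeries d) (k : ℕ) :
    l2 F k ≤ ‖evalHom F k (fun i => (V i).toContinuousLinearMap)‖ := by
  obtain ⟨v, hv⟩ := exists_norm_eq H zero_le_one
  have h := norm_sq_sum_isometry V hV k F.coeff v
  have h2 : evalHom F k (fun i => (V i).toContinuousLinearMap) v =
    ∑ w ∈ words d k, F.coeff w • wordProd (fun i => (V i).toContinuousLinearMap) w v := by
    simp [evalHom]
  rw [← h2, hv, one_pow, mul_one] at h
  rw [l2, ← h, Real.sqrt_sq (norm_nonneg _)]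
  simpa [hv] using ContinuousLinearMap.le_opNorm
    (evalHom F k (fun i => (V i).toContinuousLinearMap)) v

lemma evalHom_eq_zero {F : FreeSeries d} {k : ℕ} (h : ∀ w ∈ words d k, F.coeff w = 0)
    (T : Fin d → H →L[ℂ] H) : evalHom F k T = 0 :=
  Finset.sum_eq_zero fun w hw => by rw [h w hw, zero_smul]

lemma evalHom_eq_zero_of_ne {F : FreeSeries d} {m : ℕ}
    (h : ∀ w : Word d, w.toList.length ≠ m → F.coeff w = 0) (T : Fin d → H →L[ℂ] H) {k : ℕ}
    (hk : k ≠ m) : evalHom F k T = 0 :=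
  evalHom_eq_zero (fun w hw => h w (by rw [mem_words.1 hw]; exact hk)) T

lemma summable_evalHom_of_homogeneous {F : FreeSeries d} {m : ℕ}
    (h : ∀ w : Word d, w.toList.length ≠ m → F.coeff w = 0) (T : Fin d → H →L[ℂ] H) :
    Summable fun k => ‖evalHom F k T‖ :=
  summable_of_ne_finset_zero (s := {m}) fun k hk => by
    rw [evalHom_eq_zero_of_ne h T (by simpa using hk), norm_zero]

lemma summable_evalHom_mul {F G : FreeSeries d} {T : Fin d → H →L[ℂ] H}
    (hF : Summable fun k => ‖evalHom F k T‖) (hG : Summable fun k => ‖evalHom G k T‖) :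
    Summable fun k => ‖evalHom (F * G) k T‖ := by
  have h := summable_norm_sum_mul_antidiagonal_of_summable_norm hF hG
  refine h.congr fun k => ?_
  rw [evalHom_mul]

variable [CompleteSpace H]

lemma sum_norm_sq_adjoint (T : Fin d → H →L[ℂ] H) (u : H) :
    ∑ i, ‖ContinuousLinearMap.adjoint (T i) u‖ ^ 2 ≤
      ‖∑ i, T i * ContinuousLinearMap.adjoint (T i)‖ * ‖u‖ ^ 2 := by
  have h : ((∑ i, ‖ContinuousLinearMap.adjoint (T i) u‖ ^ 2 : ℝ) : ℂ) =
      inner ℂ u ((∑ i, T i * ContinuousLinearMap.adjoint (T i)) u) := by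
    rw [sum_apply, inner_sum, Complex.ofReal_sum]
    refine Finset.sum_congr rfl fun i _ => ?_
    rw [ContinuousLinearMap.mul_def, ContinuousLinearMap.comp_apply, ← ContinuousLinearMap.adjoint_inner_left,
      inner_self_eq_norm_sq_to_K]
    simp
  have h0 : 0 ≤ ∑ i, ‖ContinuousLinearMap.adjoint (T i) u‖ ^ 2 :=
    Finset.sum_nonneg fun _ _ => sq_nonneg _
  calc ∑ i, ‖ContinuousLinearMap.adjoint (T i) u‖ ^ 2
      = ‖((∑ i, ‖ContinuousLinearMap.adjoint (T i) u‖ ^ 2 : ℝ) : ℂ)‖ := by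
        rw [Complex.norm_real, Real.norm_of_nonneg h0]
    _ ≤ ‖u‖ * (‖∑ i, T i * ContinuousLinearMap.adjoint (T i)‖ * ‖u‖) := by
        rw [h]
        exact (norm_inner_le_norm _ _).trans (mul_le_mul_of_nonneg_left
          (ContinuousLinearMap.le_opNorm _ _) (norm_nonneg _))
    _ = _ := by ring

lemma sum_norm_sq_adjoint_word {T : Fin d → H →L[ℂ] H} {y : ℝ}
    (hT : ‖∑ i, T i * ContinuousLinearMap.adjoint (T i)‖ ≤ y ^ 2) (k : ℕ) (u : H) :
    ∑ w ∈ words d k, ‖ContinuousLinearMap.adjoint (wordProd T w) u‖ ^ 2 ≤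
      (y ^ k) ^ 2 * ‖u‖ ^ 2 := by
  induction k generalizing u with
  | zero =>
    rw [sum_words_zero, wordProd_one, ← ContinuousLinearMap.star_eq_adjoint, star_one]
    simp
  | succ k ih =>
    rw [sum_words_succ]
    have : ∀ (a : Fin d) (w : Word d),
        ContinuousLinearMap.adjoint (wordProd T (FreeMonoid.of a * w)) u =
        ContinuousLinearMap.adjoint (wordProd T w) (ContinuousLinearMap.adjoint (T a) u) := by
      intro a w
      rw [wordProd_cons, ContinuousLinearMap.mul_def, ContinuousLinearMap.adjoint_comp]
      rfl
    simp only [this]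
    calc _ ≤ ∑ a, (y ^ k) ^ 2 * ‖ContinuousLinearMap.adjoint (T a) u‖ ^ 2 :=
          Finset.sum_le_sum fun a _ => ih _
      _ ≤ (y ^ k) ^ 2 * (y ^ 2 * ‖u‖ ^ 2) := by
          rw [← Finset.mul_sum]
          exact mul_le_mul_of_nonneg_left ((sum_norm_sq_adjoint T u).trans
            (mul_le_mul_of_nonneg_right hT (sq_nonneg _))) (sq_nonneg _)
      _ = _ := by ring

lemma norm_evalHom_le {T : Fin d → H →L[ℂ] H} {y : ℝ} (hy : 0 ≤ y)
    (hT : ‖∑ i, T i * ContinuousLinearMap.adjoint (T i)‖ ≤ y ^ 2) (F : FreeSeries d) (k : ℕ) :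
    ‖evalHom F k T‖ ≤ y ^ k * l2 F k := by
  have hyk : 0 ≤ y ^ k := pow_nonneg hy k
  refine ContinuousLinearMap.opNorm_le_bound _ (mul_nonneg hyk (l2_nonneg _ _)) fun v => ?_
  set u := evalHom F k T v with hu
  have h1 : inner ℂ u u =
      ∑ w ∈ words d k, F.coeff w * inner ℂ (ContinuousLinearMap.adjoint (wordProd T w) u) v := by
    conv_lhs => rw [hu, ← hu]
    nth_rewrite 2 [hu]
    simp [evalHom, ContinuousLinearMap.adjoint_inner_left]
  have h2 : ‖u‖ ^ 2 ≤ ∑ w ∈ words d k,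
      ‖F.coeff w‖ * ‖ContinuousLinearMap.adjoint (wordProd T w) u‖ * ‖v‖ := by
    have : ‖u‖ ^ 2 = ‖inner ℂ u u‖ := by
      rw [inner_self_eq_norm_sq_to_K]; simp
    rw [this, h1]
    refine (norm_sum_le _ _).trans (Finset.sum_le_sum fun w _ => ?_)
    rw [norm_mul, mul_assoc]
    exact mul_le_mul_of_nonneg_left (norm_inner_le_norm _ _) (norm_nonneg _)
  have h3 : ∑ w ∈ words d k, ‖F.coeff w‖ * ‖ContinuousLinearMap.adjoint (wordProd T w) u‖ ≤
      l2 F k * (y ^ k * ‖u‖) := by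
    refine (Real.sum_mul_le_sqrt_mul_sqrt _ _ _).trans ?_
    refine mul_le_mul_of_nonneg_left ?_ (l2_nonneg _ _)
    rw [Real.sqrt_le_left (by positivity), mul_pow]
    exact sum_norm_sq_adjoint_word hT k u
  rw [← Finset.sum_mul] at h2
  rcases (norm_nonneg u).eq_or_lt with h0 | h0
  · rw [← h0]
    exact mul_nonneg (mul_nonneg hyk (l2_nonneg _ _)) (norm_nonneg _)
  · refine le_of_mul_le_mul_left ?_ h0
    calc ‖u‖ * ‖u‖ = ‖u‖ ^ 2 := by ring
      _ ≤ l2 F k * (y ^ k * ‖u‖) * ‖v‖ :=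
        h2.trans (mul_le_mul_of_nonneg_right h3 (norm_nonneg _))
      _ = _ := by ring

lemma norm_sum_isometry_le (V : Fin d → H →ₗᵢ[ℂ] H) (hV : OrthogonalFamily ℂ (fun _ => H) V) :
    ‖∑ i, (V i).toContinuousLinearMap *
      ContinuousLinearMap.adjoint (V i).toContinuousLinearMap‖ ≤ 1 := by
  set P := ∑ i, (V i).toContinuousLinearMap *
      ContinuousLinearMap.adjoint (V i).toContinuousLinearMap with hP
  have h1 : ∀ u, ‖P u‖ ^ 2 ≤ ‖P‖ * ‖u‖ ^ 2 := by
    intro u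
    have : P u = ∑ i, V i (ContinuousLinearMap.adjoint (V i).toContinuousLinearMap u) := by
      simp [hP]
    rw [this, hV.norm_sum]
    exact sum_norm_sq_adjoint _ u
  have h2 : ‖P‖ ≤ √‖P‖ := by
    refine ContinuousLinearMap.opNorm_le_bound _ (Real.sqrt_nonneg _) fun u => ?_
    rw [← Real.sqrt_sq (norm_nonneg (P u)), ← Real.sqrt_sq (norm_nonneg u), ← Real.sqrt_mul
      (norm_nonneg _)]
    exact Real.sqrt_le_sqrt (h1 u)
  have h3 := Real.sq_sqrt (norm_nonneg P)
  by_contra! h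
  have h4 : 1 < √‖P‖ := by rw [Real.lt_sqrt] <;> simp [h]
  nlinarith

lemma smul_isometry_mem_opBall (V : Fin d → H →ₗᵢ[ℂ] H)
    (hV : OrthogonalFamily ℂ (fun _ => H) V) {x y : ℝ} (hy : 0 ≤ y) (hyx : y < x) :
    (fun i => (y : ℂ) • (V i).toContinuousLinearMap) ∈ opBall H d x := by
  have : ∑ i, ((y : ℂ) • (V i).toContinuousLinearMap) *
      ContinuousLinearMap.adjoint ((y : ℂ) • (V i).toContinuousLinearMap) =
      (y : ℂ) ^ 2 • ∑ i, (V i).toContinuousLinearMap *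
      ContinuousLinearMap.adjoint (V i).toContinuousLinearMap := by
    rw [Finset.smul_sum]
    refine Finset.sum_congr rfl fun i _ => ?_
    rw [map_smulₛₗ, smul_mul_smul_comm]
    simp [pow_two]
  rw [opBall, Set.mem_ofPred_eq, this, norm_smul, norm_pow, Complex.norm_real,
    Real.norm_of_nonneg hy]
  have := norm_sum_isometry_le V hV
  have h2 : y ^ 2 < x ^ 2 := by gcongr
  nlinarith [sq_nonneg y]

lemma exists_isometries (hH : ¬ FiniteDimensional ℂ H) (d : ℕ) :
    ∃ V : Fin d → H →ₗᵢ[ℂ] H, OrthogonalFamily ℂ (fun _ => H) V := by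
  obtain ⟨ι, b, -⟩ := exists_hilbertBasis ℂ H
  have hι : Infinite ι := by
    by_contra h
    have : Finite ι := not_infinite_iff_finite.1 h
    have := Fintype.ofFinite ι
    exact hH b.toOrthonormalBasis.toBasis.finiteDimensional_of_finite
  obtain ⟨e⟩ : Nonempty (Fin d × ι ↪ ι) := by
    have h : Nonempty (ι × ℕ ≃ ι) := by
      rw [← Cardinal.eq]
      simp
    obtain ⟨e⟩ := h
    exact ⟨⟨fun p => e (p.2, p.1), fun p q h => by
      have := e.injective h
      simp only [Prod.mk.injEq] at this
      exact Prod.ext (Fin.ext this.2) this.1⟩⟩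
  have ho : ∀ i : Fin d, Orthonormal ℂ (fun j => b (e (i, j))) := fun i =>
    b.orthonormal.comp (fun j => e (i, j)) fun j j' h => by simpa using h
  refine ⟨fun i => (ho i).orthogonalFamily.linearIsometry.comp
    b.repr.toLinearIsometry, ?_⟩
  intro i j hij u v
  have h1 : ∀ (j' : ι) (v : H), inner ℂ (b (e (i, j')))
      ((ho j).orthogonalFamily.linearIsometry (b.repr v)) = 0 := by
    intro j' v
    have hs := ((ho j).orthogonalFamily.hasSum_linearIsometry (b.repr v)).mapL
      (innerSL ℂ (b (e (i, j'))))
    refine hs.unique ?_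
    convert hasSum_zero with k
    have : e (i, j') ≠ e (j, k) := fun h => hij (by simpa using congrArg Prod.fst (e.injective h))
    simp [b.orthonormal.inner_eq_zero this]
  have hs := ((ho i).orthogonalFamily.hasSum_linearIsometry (b.repr u)).mapL
      (innerSL ℂ ((ho j).orthogonalFamily.linearIsometry (b.repr v)))
  have h0 : inner ℂ ((ho j).orthogonalFamily.linearIsometry (b.repr v))
      ((ho i).orthogonalFamily.linearIsometry (b.repr u)) = 0 := by
    refine hs.unique ?_
    convert hasSum_zero with k
    have := inner_eq_zero_symm.1 (h1 k v)
    simp [this]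
  exact inner_eq_zero_symm.1 h0

end Operators

section Algebra

variable (H : Type*) [NormedAddCommGroup H] [InnerProductSpace ℂ H] [CompleteSpace H] (d : ℕ)

/-- The algebra `𝓕_d` of free holomorphic functions on the open unit ball: the formal free series
`F` such that `∑ ‖F_k(T_1, …, T_d)‖ < ∞` for all `T` in the open unit ball of `B(H)^d`. -/
def freeHol : Subalgebra ℂ (FreeSeries d) where
  carrier := {F | ∀ T ∈ opBall H d 1, Summable fun k => ‖evalHom F k T‖}
  add_mem' {F G} hF hG T hT := by
    refine ((hF T hT).add (hG T hT)).of_nonneg_of_le (fun _ => norm_nonneg _) fun k => ?_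
    rw [evalHom_add]
    exact norm_add_le _ _
  mul_mem' {F G} hF hG T hT := summable_evalHom_mul (hF T hT) (hG T hT)
  algebraMap_mem' c T _ := by
    refine summable_evalHom_of_homogeneous (m := 0) (fun w hw => ?_) T
    rw [Algebra.algebraMap_eq_smul_one, FreeSeries.coeff_smul, FreeSeries.coeff_one,
      if_neg (by simpa using hw), smul_zero]

variable {H d}

/-- The variable `z_i` as an element of `𝓕_d`. -/
def zvar (i : Fin d) : freeHol H d := ⟨FreeSeries.Z i, fun T _ =>
  summable_evalHom_of_homogeneous (m := 1) (fun w hw => if_neg fun h => hw (by simp [h])) T⟩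

/-- `‖F‖_x = sup { ‖∑ F_k(T_1, …, T_d)‖ : T ∈ [B(H)^d]_x }`. -/
noncomputable def ballNorm (x : ℝ) (F : freeHol H d) : ℝ :=
  ⨆ T : opBall H d x, ‖∑' k, evalHom F.1 k T.1‖

lemma opBall_mono {x y : ℝ} (hx : 0 ≤ x) (hxy : x ≤ y) : opBall H d x ⊆ opBall H d y :=
  fun _ hT => lt_of_lt_of_le hT (pow_le_pow_left₀ hx hxy 2)

lemma summable_l2 [hH : Fact (¬ FiniteDimensional ℂ H)] (F : freeHol H d) {y : ℝ} (hy : 0 ≤ y)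
    (hy1 : y < 1) : Summable fun k => y ^ k * l2 F.1 k := by
  obtain ⟨V, hV⟩ := exists_isometries hH.out d
  have : Nontrivial H := by
    by_contra h
    rw [not_nontrivial_iff_subsingleton] at h
    exact hH.out inferInstance
  refine (F.2 _ (smul_isometry_mem_opBall V hV hy hy1)).of_nonneg_of_le
    (fun k => mul_nonneg (pow_nonneg hy k) (l2_nonneg _ _)) fun k => ?_
  rw [evalHom_smul_arg, norm_smul, norm_pow, Complex.norm_real, Real.norm_of_nonneg hy]
  exact mul_le_mul_of_nonneg_left (l2_le_norm_evalHom V hV F.1 k) (pow_nonneg hy k)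

lemma norm_eval_le [Fact (¬ FiniteDimensional ℂ H)] (F : freeHol H d) {x : ℝ} (hx : 0 ≤ x)
    (hx1 : x < 1) {T : Fin d → H →L[ℂ] H} (hT : T ∈ opBall H d x) :
    ‖∑' k, evalHom F.1 k T‖ ≤ ∑' k, x ^ k * l2 F.1 k := by
  have h := F.2 T (opBall_mono hx hx1.le hT)
  exact (norm_tsum_le_tsum_norm h).trans
    (h.tsum_le_tsum (fun k => norm_evalHom_le hx (le_of_lt hT) F.1 k) (summable_l2 F hx hx1))

lemma ballNorm_nonneg (x : ℝ) (F : freeHol H d) : 0 ≤ ballNorm x F :=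
  Real.iSup_nonneg fun _ => norm_nonneg _

lemma bddAbove_ballNorm [Fact (¬ FiniteDimensional ℂ H)] (F : freeHol H d) {x : ℝ} (hx : 0 ≤ x)
    (hx1 : x < 1) : BddAbove (Set.range fun T : opBall H d x => ‖∑' k, evalHom F.1 k T.1‖) :=
  ⟨_, by rintro _ ⟨T, rfl⟩; exact norm_eval_le F hx hx1 T.2⟩

lemma ballNorm_le_tsum [Fact (¬ FiniteDimensional ℂ H)] (F : freeHol H d) {x : ℝ} (hx : 0 ≤ x)
    (hx1 : x < 1) : ballNorm x F ≤ ∑' k, x ^ k * l2 F.1 k :=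
  Real.iSup_le (fun T => norm_eval_le F hx hx1 T.2)
    (tsum_nonneg fun k => mul_nonneg (pow_nonneg hx k) (l2_nonneg _ _))

lemma norm_eval_le_ballNorm [Fact (¬ FiniteDimensional ℂ H)] (F : freeHol H d) {x : ℝ}
    (hx : 0 ≤ x) (hx1 : x < 1) {T : Fin d → H →L[ℂ] H} (hT : T ∈ opBall H d x) :
    ‖∑' k, evalHom F.1 k T‖ ≤ ballNorm x F :=
  le_ciSup (bddAbove_ballNorm F hx hx1) ⟨T, hT⟩

lemma ballNorm_mul_le [Fact (¬ FiniteDimensional ℂ H)] (F G : freeHol H d) {x : ℝ}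
    (hx : 0 ≤ x) (hx1 : x < 1) : ballNorm x (F * G) ≤ ballNorm x F * ballNorm x G := by
  refine Real.iSup_le (fun T => ?_) (mul_nonneg (ballNorm_nonneg _ _) (ballNorm_nonneg _ _))
  have hT := opBall_mono hx hx1.le T.2
  have : ∑' k, evalHom (F * G).1 k T.1 = (∑' k, evalHom F.1 k T.1) * ∑' k, evalHom G.1 k T.1 := by
    rw [tsum_mul_tsum_eq_tsum_sum_antidiagonal_of_summable_norm (F.2 T hT) (G.2 T hT)]
    exact tsum_congr fun k => evalHom_mul _ _ _ _
  rw [this]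
  exact (norm_mul_le _ _).trans (mul_le_mul (norm_eval_le_ballNorm F hx hx1 T.2)
    (norm_eval_le_ballNorm G hx hx1 T.2) (norm_nonneg _) (ballNorm_nonneg _ _))

/-- For `0 < x < 1` the function `‖·‖_x` is a seminorm on `𝓕_d`. -/
noncomputable def ballSeminorm [Fact (¬ FiniteDimensional ℂ H)] (x : Set.Ioo (0 : ℝ) 1) :
    Seminorm ℂ (freeHol H d) :=
  Seminorm.of (ballNorm x.1)
    (fun F G => Real.iSup_le (fun T => by
        have hT := opBall_mono x.2.1.le x.2.2.le T.2
        have : ∑' k, evalHom (F + G).1 k T.1 =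
            (∑' k, evalHom F.1 k T.1) + ∑' k, evalHom G.1 k T.1 := by
          rw [← (F.2 T hT).of_norm.tsum_add (G.2 T hT).of_norm]
          exact tsum_congr fun k => evalHom_add _ _ _ _
        rw [this]
        exact (norm_add_le _ _).trans (add_le_add
          (norm_eval_le_ballNorm F x.2.1.le x.2.2 T.2)
          (norm_eval_le_ballNorm G x.2.1.le x.2.2 T.2)))
      (add_nonneg (ballNorm_nonneg _ _) (ballNorm_nonneg _ _)))
    (fun c F => by
      rw [ballNorm, ballNorm, Real.mul_iSup_of_nonneg (norm_nonneg c)]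
      refine iSup_congr fun T => ?_
      have hT := opBall_mono x.2.1.le x.2.2.le T.2
      rw [← norm_smul, ← (F.2 T hT).of_norm.tsum_const_smul c]
      exact congrArg _ (tsum_congr fun k => evalHom_smul _ _ _ _))

/-- The locally convex topology of `𝓕_d`, generated by the seminorms `‖·‖_x`, `0 < x < 1`. -/
noncomputable instance [Fact (¬ FiniteDimensional ℂ H)] : TopologicalSpace (freeHol H d) :=
  (SeminormFamily.moduleFilterBasis (𝕜 := ℂ)
    (fun x : Set.Ioo (0 : ℝ) 1 => ballSeminorm (H := H) (d := d) x)).topology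

instance : Nonempty (Set.Ioo (0 : ℝ) 1) := ⟨⟨1 / 2, by norm_num, by norm_num⟩⟩

lemma withSeminorms_freeHol [Fact (¬ FiniteDimensional ℂ H)] :
    WithSeminorms (fun x : Set.Ioo (0 : ℝ) 1 => ballSeminorm (H := H) (d := d) x) := ⟨rfl⟩

lemma continuous_mul_left_freeHol [Fact (¬ FiniteDimensional ℂ H)] (F : freeHol H d) :
    Continuous fun G : freeHol H d => F * G := by
  refine withSeminorms_freeHol.continuous_of_isBounded withSeminorms_freeHol
    (LinearMap.mulLeft ℂ F) fun x => ⟨{x}, ⟨ballNorm x.1 F, ballNorm_nonneg _ _⟩, fun G => ?_⟩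
  simpa using! ballNorm_mul_le F G x.2.1.le x.2.2

lemma continuous_mul_right_freeHol [Fact (¬ FiniteDimensional ℂ H)] (G : freeHol H d) :
    Continuous fun F : freeHol H d => F * G := by
  refine withSeminorms_freeHol.continuous_of_isBounded withSeminorms_freeHol
    (LinearMap.mulRight ℂ G) fun x => ⟨{x}, ⟨ballNorm x.1 G, ballNorm_nonneg _ _⟩, fun F => ?_⟩
  have := ballNorm_mul_le F G x.2.1.le x.2.2
  rw [mul_comm] at this
  simpa using! this

/-- The algebra `𝓟_d` of noncommutative polynomials: the free algebra on `d` indeterminates,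
with basis the words in `d` letters. -/
abbrev Poly (d : ℕ) : Type := MonoidAlgebra ℂ (Word d)

/-- The embedding of `𝓟_d` into `𝓕_d`, which sends the `i`-th generator to `z_i`. -/
noncomputable def ofPoly : Poly d →ₐ[ℂ] freeHol H d :=
  MonoidAlgebra.lift ℂ (freeHol H d) (Word d) (FreeMonoid.lift zvar)

lemma coeff_lift_zvar [DecidableEq (Word d)] (w v : Word d) :
    (FreeMonoid.lift (zvar (H := H)) w).1.coeff v = if v = w then 1 else 0 := by
  induction w using FreeMonoid.inductionOn' generalizing v with
  | one =>
    rw [map_one]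
    change (if v.toList = [] then (1 : ℂ) else 0) = _
    refine if_congr ?_ rfl rfl
    exact FreeMonoid.toList.injective.eq_iff (a := v) (b := 1)
  | of_mul a w ih =>
    rw [map_mul, FreeMonoid.lift_eval_of]
    change (FreeSeries.Z a * (FreeMonoid.lift (zvar (H := H)) w).1).coeff v = _
    rw [FreeSeries.coeff_mul]
    induction v using FreeMonoid.inductionOn' with
    | one =>
      rw [if_neg (by intro h; simpa using congrArg FreeMonoid.toList h)]
      simp [FreeSeries.Z]
    | of_mul b v =>
      rw [Finset.sum_eq_single 1]
      · rw [ih]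
        simp only [FreeSeries.Z, FreeMonoid.toList_mul, FreeMonoid.toList_of,
          FreeMonoid.toList_ofList, List.singleton_append, List.take_succ_cons, List.take_zero,
          List.drop_succ_cons, List.drop_zero, FreeMonoid.ofList_toList, List.cons.injEq,
          and_true, ite_mul, one_mul, zero_mul, ← ite_and]
        refine if_congr ?_ rfl rfl
        rw [← FreeMonoid.toList.injective.eq_iff (a := FreeMonoid.of b * v),
          ← FreeMonoid.toList.injective.eq_iff (a := v)]
        simp
      · intro i hi h1
        have hi' : i < v.toList.length + 2 := by
          have : i ≤ v.toList.length + 1 := by simpa using hi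
          omega
        have : (FreeMonoid.ofList ((FreeMonoid.of b * v).toList.take i)).toList ≠ [a] := by
          intro h
          have := congrArg List.length h
          simp at this
          omega
        simp only [FreeSeries.Z]
        rw [if_neg this, zero_mul]
      · intro h; simp at h

lemma coeff_ofPoly (p : Poly d) (v : Word d) : (ofPoly (H := H) p).1.coeff v = p.coeff v := by
  classical
  induction p using MonoidAlgebra.induction_linear with
  | zero => rw [map_zero]; rfl
  | add p q hp hq =>
    rw [map_add, MonoidAlgebra.coeff_add, Finsupp.add_apply, ← hp, ← hq]
    rfl
  | single w c =>
    have : ofPoly (H := H) (MonoidAlgebra.single w c) = c • FreeMonoid.lift zvar w := by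
      simp [ofPoly]
    rw [this]
    change c * (FreeMonoid.lift (zvar (H := H)) w).1.coeff v = _
    rw [coeff_lift_zvar, MonoidAlgebra.coeff_single, Finsupp.single_apply]
    simp [eq_comm]

/-- The truncation of a free series to the words of length less than `n`. -/
noncomputable def truncPoly (F : FreeSeries d) (n : ℕ) : Poly d :=
  ∑ k ∈ Finset.range n, ∑ w ∈ words d k, MonoidAlgebra.single w (F.coeff w)

lemma coeff_truncPoly (F : FreeSeries d) (n : ℕ) (v : Word d) :
    (truncPoly F n).coeff v = if v.toList.length < n then F.coeff v else 0 := by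
  classical
  have : ∀ k, (∑ w ∈ words d k, (MonoidAlgebra.single w (F.coeff w) : Poly d)).coeff v =
      if v.toList.length = k then F.coeff v else 0 := by
    intro k
    rw [MonoidAlgebra.coeff_sum, Finsupp.finsetSum_apply]
    simp only [MonoidAlgebra.coeff_single, Finsupp.single_apply, Finset.sum_ite_eq', mem_words]
  rw [truncPoly, MonoidAlgebra.coeff_sum, Finsupp.finsetSum_apply]
  simp only [this, Finset.sum_ite_eq, Finset.mem_range]

lemma dense_range_ofPoly [Fact (¬ FiniteDimensional ℂ H)] :
    DenseRange (ofPoly : Poly d → freeHol H d) := by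
  intro F
  refine mem_closure_of_tendsto (f := fun n => ofPoly (truncPoly F.1 n)) (b := Filter.atTop) ?_
    (Filter.Eventually.of_forall fun n => Set.mem_range_self _)
  rw [withSeminorms_freeHol.tendsto_nhds]
  intro x ε hε
  have hs := summable_l2 F x.2.1.le x.2.2
  have ht := tendsto_sum_nat_add fun k => x.1 ^ k * l2 F.1 k
  filter_upwards [ht.eventually (gt_mem_nhds hε)] with n hn
  refine lt_of_le_of_lt ?_ hn
  rw [← map_sub_rev]
  refine (ballNorm_le_tsum _ x.2.1.le x.2.2).trans (le_of_eq ?_)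
  have hc : ∀ v : Word d, (F - ofPoly (truncPoly F.1 n)).1.coeff v =
      if v.toList.length < n then 0 else F.1.coeff v := by
    intro v
    change F.1.coeff v - (ofPoly (H := H) (truncPoly F.1 n)).1.coeff v = _
    rw [coeff_ofPoly, coeff_truncPoly]
    split_ifs <;> simp
  have hl : ∀ k, l2 (F - ofPoly (truncPoly F.1 n)).1 k = if k < n then 0 else l2 F.1 k := by
    intro k
    rw [l2, Finset.sum_congr rfl fun w hw => by rw [hc, mem_words.1 hw]]
    split_ifs
    · simp
    · rfl
  rw [← (summable_l2 (F - ofPoly (truncPoly F.1 n)) x.2.1.le x.2.2).sum_add_tsum_nat_add n,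
    Finset.sum_eq_zero, zero_add]
  · refine tsum_congr fun k => ?_
    rw [hl, if_neg (by omega)]
  · intro k hk
    rw [hl, if_pos (Finset.mem_range.1 hk), mul_zero]

end Algebra

section Ideals

variable {d : ℕ}

/-- The homogeneous component `𝓟_d^k`: the linear span of the words of length `k`. -/
noncomputable def homPoly (d k : ℕ) : Submodule ℂ (Poly d) :=
  Submodule.span ℂ ((fun w : Word d => MonoidAlgebra.single w (1 : ℂ)) '' {w | w.toList.length = k})

/-- A two-sided graded ideal `I = ⨁_{k ≥ 1} I^k` of `𝓟_d`, where `I^k = I ∩ 𝓟_d^k`. -/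
structure GradedIdeal (d : ℕ) where
  toIdeal : Ideal (Poly d)
  isTwoSided : toIdeal.IsTwoSided
  graded : toIdeal.restrictScalars ℂ =
    ⨆ (k : ℕ) (_ : 1 ≤ k), toIdeal.restrictScalars ℂ ⊓ homPoly d k

variable (H : Type*) [NormedAddCommGroup H] [InnerProductSpace ℂ H] [CompleteSpace H]
  [Fact (¬ FiniteDimensional ℂ H)]

/-- The closure `Ī` in `𝓕_d` of a graded ideal `I ⊆ 𝓟_d ⊆ 𝓕_d`. -/
noncomputable def GradedIdeal.closure (I : GradedIdeal d) : Ideal (freeHol H d) where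
  carrier := _root_.closure (ofPoly '' (I.toIdeal : Set (Poly d)))
  zero_mem' := subset_closure ⟨0, I.toIdeal.zero_mem, map_zero _⟩
  add_mem' {F G} hF hG := by
    have h : IsTopologicalAddGroup (freeHol H d) := withSeminorms_freeHol.topologicalAddGroup
    refine map_mem_closure₂ h.toContinuousAdd.continuous_add hF hG ?_
    rintro _ ⟨p, hp, rfl⟩ _ ⟨q, hq, rfl⟩
    exact ⟨p + q, I.toIdeal.add_mem hp hq, map_add _ _ _⟩
  smul_mem' F G hG := by
    have h : ∀ p : Poly d,
        ofPoly p * G ∈ _root_.closure (ofPoly (H := H) '' (I.toIdeal : Set (Poly d))) := by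
      intro p
      refine map_mem_closure (continuous_mul_left_freeHol (ofPoly p)) hG ?_
      rintro _ ⟨q, hq, rfl⟩
      exact ⟨p * q, I.toIdeal.mul_mem_left p hq, map_mul _ _ _⟩
    have := map_mem_closure (continuous_mul_right_freeHol G) (dense_range_ofPoly F)
      (t := _root_.closure (ofPoly (H := H) '' (I.toIdeal : Set (Poly d))))
      (by rintro _ ⟨p, rfl⟩; exact h p)
    rwa [closure_closure] at this

instance (I : GradedIdeal d) : (I.closure H).IsTwoSided where
  mul_mem_of_left {G} F hG := by
    change G ∈ _root_.closure (ofPoly '' (I.toIdeal : Set (Poly d))) at hG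
    have := I.isTwoSided
    have h : ∀ p : Poly d,
        G * ofPoly p ∈ _root_.closure (ofPoly (H := H) '' (I.toIdeal : Set (Poly d))) := by
      intro p
      refine map_mem_closure (f := fun F => F * ofPoly p)
        (continuous_mul_right_freeHol (ofPoly p)) hG ?_
      rintro _ ⟨q, hq, rfl⟩
      exact ⟨q * p, I.toIdeal.mul_mem_right p hq, map_mul _ _ _⟩
    have := map_mem_closure (continuous_mul_left_freeHol G) (dense_range_ofPoly F)
      (t := _root_.closure (ofPoly (H := H) '' (I.toIdeal : Set (Poly d))))
      (by rintro _ ⟨p, rfl⟩; exact h p)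
    rwa [closure_closure] at this

/-- The locally convex algebra `𝓕_d / Ī`, with its quotient topology. -/
abbrev FreeHolQuot (I : GradedIdeal d) : Type _ := freeHol H d ⧸ I.closure H

variable {H}

/-- The quotient seminorm on `𝓕_d / Ī` of the seminorm `‖·‖_r` on `𝓕_d`. -/
noncomputable def quotNorm (r : ℝ) {I : GradedIdeal d} (q : FreeHolQuot H I) : ℝ :=
  sInf (ballNorm r '' {F : freeHol H d | Ideal.Quotient.mk (I.closure H) F = q})

end Ideals

section Fock

/-- The full Fock space `𝓕(ℂ^d)`, the Hilbert direct sum of the spaces `(ℂ^d)^{⊗k}`, `k ≥ 0`,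
realized as the `ℓ²`-space over the words in `d` letters: the word `g_{i_1} ⋯ g_{i_k}` indexes the
orthonormal basis vector `e_{i_1} ⊗ ⋯ ⊗ e_{i_k}`. -/
abbrev Fock (d : ℕ) : Type := lp (fun _ : Word d => ℂ) 2

open scoped Classical in
/-- The basis vector `e_{i_1} ⊗ ⋯ ⊗ e_{i_k}` of the Fock space. -/
noncomputable def fockBasis {d : ℕ} (w : Word d) : Fock d := lp.single 2 w (1 : ℂ)

/-- The linear map `Ev : 𝓟_d → 𝓕(ℂ^d)` with `s_{i_1} ⋯ s_{i_k} ↦ e_{i_1} ⊗ ⋯ ⊗ e_{i_k}`. -/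
noncomputable def Ev (d : ℕ) : Poly d →ₗ[ℂ] Fock d where
  toFun p := p.coeff.sum fun w c => c • fockBasis w
  map_add' p q := by
    rw [MonoidAlgebra.coeff_add]
    exact Finsupp.sum_add_index' (fun _ => zero_smul _ _) (fun _ _ _ => add_smul _ _ _)
  map_smul' c p := by
    rw [MonoidAlgebra.coeff_smul, Finsupp.sum_smul_index' (h := fun w c => c • fockBasis w)
      (fun _ => zero_smul _ _), Finsupp.smul_sum]
    simp [mul_smul]

variable {d : ℕ}

/-- The orthogonal projection `p_I` of the Fock space onto `Ev(I)^⊥`. -/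
noncomputable def GradedIdeal.proj (I : GradedIdeal d) : Fock d →L[ℂ] Fock d :=
  ((I.toIdeal.restrictScalars ℂ).map (Ev d))ᗮ.starProjection

/-- The space `𝓜` of all the projections `p_I`, with the strong operator topology (the topology of
pointwise convergence on the bounded operators of the Fock space). -/
def projSpace (d : ℕ) : Set (Fock d →Lₚₜ[ℂ] Fock d) :=
  Set.range fun I : GradedIdeal d =>
    ContinuousLinearMap.toPointwiseConvergenceCLM ℂ (RingHom.id ℂ) (Fock d) (Fock d) I.proj

/-- The operator `p_I` as a point of `𝓜`. -/
noncomputable def GradedIdeal.toProjSpace (I : GradedIdeal d) : projSpace d :=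
  ⟨_, Set.mem_range_self I⟩

end Fock

/-- A bundle of locally convex algebras `(E, X, π, 𝓝)`. -/
structure LCABundle (E X : Type*) [TopologicalSpace E] [TopologicalSpace X] where
  proj : E → X
  continuous_proj : Continuous proj
  isOpenMap_proj : IsOpenMap proj
  surjective_proj : Function.Surjective proj
  [ring : ∀ x, Ring (proj ⁻¹' {x})]
  [algebra : ∀ x, Algebra ℂ (proj ⁻¹' {x})]
  /-- The family `𝓝` of functions on `E` which restrict to seminorms on the fibers. -/
  seminorms : Set (E → ℝ)
  isSeminorm : ∀ σ ∈ seminorms, ∀ x, ∃ p : Seminorm ℂ (proj ⁻¹' {x}), ∀ e, p e = σ e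
  directed : ∀ σ₁ ∈ seminorms, ∀ σ₂ ∈ seminorms, ∃ σ ∈ seminorms, ∃ C : ℝ, 0 < C ∧
    ∀ e, σ₁ e ≤ C * σ e ∧ σ₂ e ≤ C * σ e
  continuous_add : Continuous fun p : {p : E × E // proj p.1 = proj p.2} =>
    (((⟨p.1.1, p.2⟩ : proj ⁻¹' {proj p.1.2}) + ⟨p.1.2, rfl⟩ : proj ⁻¹' {proj p.1.2}) : E)
  continuous_smul : Continuous fun p : E × ℂ =>
    ((p.2 • (⟨p.1, rfl⟩ : proj ⁻¹' {proj p.1}) : proj ⁻¹' {proj p.1}) : E)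
  continuous_mul : Continuous fun p : {p : E × E // proj p.1 = proj p.2} =>
    (((⟨p.1.1, p.2⟩ : proj ⁻¹' {proj p.1.2}) * ⟨p.1.2, rfl⟩ : proj ⁻¹' {proj p.1.2}) : E)
  /-- The sets `{e | π(e) ∈ U, σ(e) < ε}` form a local base at the zero of each fiber. -/
  hasBasis_nhds_zero : ∀ x, (nhds ((0 : proj ⁻¹' {x}) : E)).HasBasis
    (fun i : Set X × (E → ℝ) × ℝ => (IsOpen i.1 ∧ x ∈ i.1) ∧ i.2.1 ∈ seminorms ∧ 0 < i.2.2)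
    (fun i => {e | proj e ∈ i.1 ∧ i.2.1 e < i.2.2})
  continuous_seminorm : ∀ σ ∈ seminorms, Continuous σ

namespace LCABundle

variable {E X : Type*} [TopologicalSpace E] [TopologicalSpace X]

/-- The fiber `π⁻¹(x)`, with the topology induced from `E`. -/
abbrev Fiber (B : LCABundle E X) (x : X) : Type _ := B.proj ⁻¹' {x}

attribute [instance] LCABundle.ring LCABundle.algebra

end LCABundle

end FreeHol

/-! The quotient seminorm at a single radius `r` already records the projection: if `p` is
homogeneous of degree `k`, its class modulo the closure of `I` has seminorm `r ^ k * ‖p_I (Ev p)‖`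
(`quotNorm_mk_ofPoly`). The upper bound comes from homogeneous representatives `p + q` with `q ∈ I`,
whose ball norm is at most `r ^ k` times the Fock norm. The lower bound is a Cauchy estimate
(`pow_mul_l2_le_ballNorm`): evaluating a series at multiples of isometries with orthogonal ranges,
on a unit vector orthogonal to those ranges, makes components of different degrees orthogonal, so
each one is bounded by the whole.

In the bundle, products and linear combinations of the given sections are continuous, so every
homogeneous polynomial of positive degree gives a continuous section. Composing with the continuous
norm function shows that `x ↦ ‖p_{I_x} (Ev p)‖` is continuous (`continuous_norm_proj_Ev`). In degree
0 the projection is the identity, because the ideals start in degree 1.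

For orthogonal projections, continuity of these norms suffices (`continuous_proj_apply`):
polarization gives the real parts of inner products, hence `‖p_{I_x} f - p_{I_y} f‖` for a basis
vector `f` and fixed `y`. This tends to 0 as `x → y`. Since projections are contractions, the result
passes from the span of the basis vectors to all of Fock space. -/

namespace FreeHol

/-! ### Homogeneous components of polynomials and graded ideals -/

section Poly

variable {d : ℕ}

/-- The homogeneous component of degree `k` of a noncommutative polynomial. -/
noncomputable def homComp (k : ℕ) : Poly d →ₗ[ℂ] Poly d where
  toFun p := ∑ w ∈ words d k, MonoidAlgebra.single w (p.coeff w)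
  map_add' p q := by
    simp [MonoidAlgebra.coeff_add, MonoidAlgebra.single_add, Finset.sum_add_distrib]
  map_smul' c p := by
    simp [MonoidAlgebra.coeff_smul, Finset.smul_sum, MonoidAlgebra.smul_single]

lemma homComp_apply (k : ℕ) (p : Poly d) :
    homComp k p = ∑ w ∈ words d k, MonoidAlgebra.single w (p.coeff w) := rfl

lemma coeff_homComp (k : ℕ) (p : Poly d) (v : Word d) :
    (homComp k p).coeff v = if v.toList.length = k then p.coeff v else 0 := by
  classical
  rw [homComp_apply, MonoidAlgebra.coeff_sum, Finsupp.finsetSum_apply]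
  simp only [MonoidAlgebra.coeff_single, Finsupp.single_apply, Finset.sum_ite_eq', mem_words]

lemma poly_ext {p q : Poly d} (h : ∀ w, p.coeff w = q.coeff w) : p = q :=
  MonoidAlgebra.coeff_injective (Finsupp.ext h)

lemma coeff_eq_zero_of_mem_homPoly {k : ℕ} {p : Poly d} (hp : p ∈ homPoly d k) {v : Word d}
    (hv : v.toList.length ≠ k) : p.coeff v = 0 := by
  classical
  induction hp using Submodule.span_induction with
  | mem p hp =>
    obtain ⟨w, hw, rfl⟩ := hp
    rw [MonoidAlgebra.coeff_single, Finsupp.single_apply, if_neg]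
    rintro rfl
    exact hv hw
  | zero => rfl
  | add p q _ _ hp hq => rw [MonoidAlgebra.coeff_add, Finsupp.add_apply, hp, hq, add_zero]
  | smul c p _ hp => rw [MonoidAlgebra.coeff_smul, Finsupp.smul_apply, hp, smul_zero]

lemma homComp_of_mem_homPoly {j k : ℕ} {p : Poly d} (hp : p ∈ homPoly d j) :
    homComp k p = if j = k then p else 0 := by
  refine poly_ext fun v => ?_
  rw [coeff_homComp]
  split_ifs with h1 h2 h2
  · rfl
  · exact coeff_eq_zero_of_mem_homPoly hp (by omega)
  · exact (coeff_eq_zero_of_mem_homPoly hp (by omega)).symm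
  · rfl

/-- By gradedness it is enough to check the pieces `I ∩ 𝓟_d^j`, on which `homComp k` is either the
identity or zero. -/
lemma GradedIdeal.homComp_mem (I : GradedIdeal d) (k : ℕ) {p : Poly d} (hp : p ∈ I.toIdeal) :
    homComp k p ∈ I.toIdeal := by
  have h : I.toIdeal.restrictScalars ℂ ≤ (I.toIdeal.restrictScalars ℂ).comap (homComp k) := by
    conv_lhs => rw [I.graded]
    refine iSup₂_le fun j _ q hq => ?_
    rw [Submodule.mem_comap, homComp_of_mem_homPoly hq.2]
    split_ifs
    · exact hq.1
    · exact Submodule.zero_mem _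
  exact h hp

/-- The decomposition of `I` starts in degree 1, and `homComp 0` kills every piece of positive
degree. -/
lemma GradedIdeal.coeff_one_eq_zero (I : GradedIdeal d) {p : Poly d} (hp : p ∈ I.toIdeal) :
    p.coeff 1 = 0 := by
  have h : I.toIdeal.restrictScalars ℂ ≤ LinearMap.ker (homComp (d := d) 0) := by
    conv_lhs => rw [I.graded]
    refine iSup₂_le fun j hj q hq => ?_
    rw [LinearMap.mem_ker, homComp_of_mem_homPoly hq.2, if_neg (by omega)]
  have h0 : (homComp 0 p).coeff 1 = 0 := by
    rw [show homComp 0 p = 0 from h hp]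
    rfl
  rwa [coeff_homComp, if_pos (by simp)] at h0

end Poly

/-! ### Degree projections and the projections `p_I` on Fock space -/

section Fock

variable {d : ℕ}

lemma fockBasis_apply [DecidableEq (Word d)] (w v : Word d) :
    (fockBasis w : Fock d) v = if v = w then 1 else 0 := by
  classical
  unfold fockBasis
  simp only [lp.single_apply, Pi.single_apply]
  congr

lemma inner_fockBasis (w : Word d) (f : Fock d) : inner ℂ (fockBasis w) f = f w := by
  classical
  unfold fockBasis
  rw [lp.inner_single_left]
  simp

lemma Ev_single (w : Word d) (c : ℂ) : Ev d (MonoidAlgebra.single w c) = c • fockBasis w := by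
  change (MonoidAlgebra.single w c : Poly d).coeff.sum (fun w c => c • fockBasis w) = _
  rw [MonoidAlgebra.coeff_single, Finsupp.sum_single_index (h := fun w c => c • fockBasis w) (zero_smul _ _)]

lemma Ev_apply (p : Poly d) (v : Word d) : Ev d p v = p.coeff v := by
  classical
  induction p using MonoidAlgebra.induction_linear with
  | zero => rw [map_zero]; rfl
  | add p q hp hq =>
    rw [map_add, lp.coeFn_add, Pi.add_apply, hp, hq]
    rfl
  | single w c =>
    rw [Ev_single, lp.coeFn_smul, Pi.smul_apply, fockBasis_apply, MonoidAlgebra.coeff_single,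
      Finsupp.single_apply]
    simp [eq_comm]

lemma norm_sq_Ev_homComp (k : ℕ) (p : Poly d) :
    ‖Ev d (homComp k p)‖ ^ 2 = ∑ w ∈ words d k, ‖p.coeff w‖ ^ 2 := by
  classical
  have h := lp.norm_sum_single (p := 2) (E := fun _ : Word d => ℂ) (by norm_num)
    (fun w => p.coeff w) (words d k)
  simp only [ENNReal.toReal_ofNat, Real.rpow_ofNat] at h
  rw [← h]
  congr 2
  refine lp.ext (funext fun v => ?_)
  rw [Ev_apply, coeff_homComp]
  rw [lp.coeFn_sum, Finset.sum_apply]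
  simp [Pi.single_apply, mem_words]

/-- The orthogonal projection of the Fock space onto the span of the words of length `k`. -/
noncomputable def degProj (d k : ℕ) : Fock d →L[ℂ] Fock d :=
  ∑ w ∈ words d k, (innerSL ℂ (fockBasis w)).smulRight (fockBasis w)

lemma degProj_apply (k : ℕ) (f : Fock d) :
    degProj d k f = ∑ w ∈ words d k, f w • fockBasis w := by
  simp [degProj, inner_fockBasis]

lemma degProj_eq_Ev (k : ℕ) (f : Fock d) :
    degProj d k f = Ev d (∑ w ∈ words d k, MonoidAlgebra.single w (f w)) := by
  simp [degProj_apply, Ev_single]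

lemma degProj_Ev (k : ℕ) (p : Poly d) : degProj d k (Ev d p) = Ev d (homComp k p) := by
  simp [degProj_apply, homComp_apply, Ev_single, Ev_apply]

/-- There are finitely many words of each length, so the degree `k` part of any Fock vector is a
polynomial. This lets norm information on homogeneous polynomials be applied to vectors such as `p_I
f`. -/
lemma degProj_mem_range (k : ℕ) (f : Fock d) :
    ∃ p : Poly d, homComp k p = p ∧ degProj d k f = Ev d p := by
  classical
  refine ⟨_, poly_ext fun v => ?_, degProj_eq_Ev k f⟩
  rw [coeff_homComp, MonoidAlgebra.coeff_sum, Finsupp.finsetSum_apply]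
  simp only [MonoidAlgebra.coeff_single, Finsupp.single_apply, Finset.sum_ite_eq', mem_words]
  split_ifs <;> rfl

lemma inner_degProj_left (k : ℕ) (f g : Fock d) :
    inner ℂ (degProj d k f) g = inner ℂ f (degProj d k g) := by
  rw [degProj_apply, degProj_apply, sum_inner, inner_sum]
  refine Finset.sum_congr rfl fun w _ => ?_
  rw [inner_smul_left, inner_smul_right, inner_fockBasis, ← inner_conj_symm f, inner_fockBasis,
    mul_comm]

/-- `degProj` is idempotent and symmetric, so `‖P f‖ ^ 2 = ⟪f, P f⟫`, and Cauchy–Schwarz applies. -/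
lemma norm_degProj_le (k : ℕ) (f : Fock d) : ‖degProj d k f‖ ≤ ‖f‖ := by
  have h : degProj d k (degProj d k f) = degProj d k f := by
    obtain ⟨p, hp, hf⟩ := degProj_mem_range k f
    rw [hf, degProj_Ev, hp]
  have h1 : ‖degProj d k f‖ ^ 2 ≤ ‖f‖ * ‖degProj d k f‖ := by
    have := norm_inner_le_norm (𝕜 := ℂ) f (degProj d k f)
    rwa [← h, ← inner_degProj_left, inner_self_eq_norm_sq_to_K, h, norm_pow,
      RCLike.norm_ofReal, abs_norm] at this
  rcases (norm_nonneg (degProj d k f)).eq_or_lt with h0 | h0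
  · rw [← h0]
    exact norm_nonneg _
  · exact le_of_mul_le_mul_right (by rwa [pow_two] at h1) h0

lemma dense_span_fockBasis (f : Fock d) :
    f ∈ closure (Submodule.span ℂ (Set.range (fockBasis (d := d))) : Set (Fock d)) := by
  classical
  have h := lp.hasSum_single (E := fun _ : Word d => ℂ) (p := 2) (by norm_num) f
  refine mem_closure_of_tendsto h (Filter.Eventually.of_forall fun s => ?_)
  refine Submodule.sum_mem _ fun w _ => ?_
  have : lp.single (E := fun _ : Word d => ℂ) 2 w (f w) = f w • fockBasis w := by
    refine lp.ext (funext fun v => ?_)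
    rw [lp.coeFn_smul, Pi.smul_apply, fockBasis_apply]
    simp [Pi.single_apply]
  rw [this]
  exact Submodule.smul_mem _ _ (Submodule.subset_span ⟨w, rfl⟩)

/-- The subspace `Ev(I)` of the Fock space. -/
noncomputable def GradedIdeal.evRange (I : GradedIdeal d) : Submodule ℂ (Fock d) :=
  (I.toIdeal.restrictScalars ℂ).map (Ev d)

lemma GradedIdeal.proj_eq (I : GradedIdeal d) : I.proj = I.evRangeᗮ.starProjection := rfl

lemma GradedIdeal.degProj_mem_evRange (I : GradedIdeal d) (k : ℕ) {f : Fock d}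
    (hf : f ∈ I.evRange) : degProj d k f ∈ I.evRange := by
  obtain ⟨p, hp, rfl⟩ := hf
  rw [degProj_Ev]
  exact ⟨_, I.homComp_mem k hp, rfl⟩

lemma GradedIdeal.degProj_mem_evRange_orthogonal (I : GradedIdeal d) (k : ℕ) {f : Fock d}
    (hf : f ∈ I.evRangeᗮ) : degProj d k f ∈ I.evRangeᗮ := by
  intro g hg
  rw [← inner_degProj_left]
  exact hf _ (I.degProj_mem_evRange k hg)

/-- `degProj` preserves `Ev(I)` because `I` is graded, and therefore preserves `Ev(I)ᗮ` because it
is symmetric. Symmetry once more shows that the error `degProj (f - p_I f)` is orthogonal to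
`Ev(I)ᗮ`. -/
lemma GradedIdeal.proj_degProj (I : GradedIdeal d) (k : ℕ) (f : Fock d) :
    I.proj (degProj d k f) = degProj d k (I.proj f) := by
  rw [I.proj_eq]
  refine Submodule.eq_starProjection_of_mem_orthogonal
    (I.degProj_mem_evRange_orthogonal k (Submodule.starProjection_apply_mem _ _)) ?_
  rw [← map_sub]
  intro g hg
  rw [← inner_degProj_left]
  exact Submodule.sub_starProjection_mem_orthogonal f _
    (I.degProj_mem_evRange_orthogonal k hg)

lemma GradedIdeal.proj_Ev_of_mem (I : GradedIdeal d) {p : Poly d} (hp : p ∈ I.toIdeal) :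
    I.proj (Ev d p) = 0 := by
  rw [I.proj_eq, Submodule.starProjection_apply_eq_zero_iff]
  exact Submodule.le_orthogonal_orthogonal _ ⟨p, hp, rfl⟩

lemma GradedIdeal.norm_proj_apply_le (I : GradedIdeal d) (f : Fock d) : ‖I.proj f‖ ≤ ‖f‖ :=
  Submodule.norm_starProjection_apply_le _ f

lemma GradedIdeal.inner_proj_proj (I : GradedIdeal d) (f g : Fock d) :
    inner ℂ (I.proj f) (I.proj g) = inner ℂ (I.proj f) g := by
  rw [I.proj_eq, Submodule.inner_starProjection_left_eq_right, Submodule.inner_starProjection_left_eq_right]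
  congr 1
  exact Submodule.starProjection_eq_self_iff.2 (Submodule.starProjection_apply_mem _ _)

/-- Elements of `I` have no constant term, so the vacuum vector is orthogonal to `Ev(I)`. -/
lemma GradedIdeal.proj_fockBasis_one (I : GradedIdeal d) :
    I.proj (fockBasis 1) = fockBasis 1 := by
  rw [I.proj_eq, Submodule.starProjection_eq_self_iff, Submodule.mem_orthogonal']
  rintro _ ⟨p, hp, rfl⟩
  rw [inner_fockBasis, Ev_apply, I.coeff_one_eq_zero hp]

/-- Up to `ε`, the norm of `p_I (Ev p)` bounds the norm of the degree `k` part of some element of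
`p + I`. -/
lemma GradedIdeal.exists_norm_Ev_add_lt (I : GradedIdeal d) (k : ℕ) (p : Poly d) {ε : ℝ}
    (hε : 0 < ε) :
    ∃ q ∈ I.toIdeal, ‖Ev d (homComp k (p + q))‖ < ‖I.proj (Ev d p)‖ + ε := by
  -- This difference lies in `Ev(I)ᗮᗮ`, which is only the closure of `Ev(I)`; hence the loss of `ε`.
  have h : Ev d p - I.proj (Ev d p) ∈ _root_.closure (I.evRange : Set (Fock d)) := by
    have := Submodule.sub_starProjection_mem_orthogonal (K := I.evRangeᗮ) (Ev d p)
    rwa [Submodule.orthogonal_orthogonal_eq_closure] at this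
  obtain ⟨_, ⟨q, hq, rfl⟩, hlt⟩ := Metric.mem_closure_iff.1 h ε hε
  refine ⟨-q, I.toIdeal.neg_mem hq, ?_⟩
  rw [← degProj_Ev, map_add, map_neg]
  refine (norm_degProj_le _ _).trans_lt ?_
  rw [dist_eq_norm] at hlt
  calc ‖Ev d p + -Ev d q‖ = ‖I.proj (Ev d p) + (Ev d p - I.proj (Ev d p) - Ev d q)‖ := by
        congr 1; abel
    _ ≤ _ := norm_add_le _ _
    _ < _ := by gcongr

end Fock

end FreeHol

namespace FreeHol

/-! ### Wandering vectors and the Cauchy estimate -/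

section WanderingVector

variable {H : Type*} [NormedAddCommGroup H] [InnerProductSpace ℂ H] {d : ℕ}

/-- Cancel common first letters, since isometries preserve inner products. Either two different
letters meet and the ranges are orthogonal, or one word runs out first and `v` is orthogonal to
every range. Unequal lengths exclude both running out together. -/
lemma inner_wordProd_eq_zero {V : Fin d → H →ₗᵢ[ℂ] H}
    (hV : OrthogonalFamily ℂ (fun _ => H) V) {v : H} (hv : ∀ i u, inner ℂ v (V i u) = 0)
    {w w' : Word d} (h : w.toList.length ≠ w'.toList.length) :
    inner ℂ (wordProd (fun i => (V i).toContinuousLinearMap) w v)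
      (wordProd (fun i => (V i).toContinuousLinearMap) w' v) = 0 := by
  induction w using FreeMonoid.inductionOn' generalizing w' with
  | one =>
    induction w' using FreeMonoid.inductionOn' with
    | one => exact absurd rfl h
    | of_mul b w' _ =>
      rw [wordProd_one, wordProd_cons]
      exact hv _ _
  | of_mul a w ih =>
    induction w' using FreeMonoid.inductionOn' with
    | one =>
      rw [wordProd_one, wordProd_cons, ← inner_conj_symm]
      exact (congrArg _ (hv _ _)).trans (map_zero _)
    | of_mul b w' _ =>
      rw [wordProd_cons, wordProd_cons]
      change inner ℂ (V a _) (V b _) = 0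
      rcases eq_or_ne a b with rfl | hab
      · rw [LinearIsometry.inner_map_map]
        refine ih fun h' => h ?_
        simp [h']
      · exact hV hab _ _

/-- Take `d + 1` isometries with orthogonal ranges and sacrifice the last one: any unit vector in
its range is wandering for the others. -/
lemma exists_isometries_wandering (hH : ¬ FiniteDimensional ℂ H) [CompleteSpace H] (d : ℕ) :
    ∃ V : Fin d → H →ₗᵢ[ℂ] H, OrthogonalFamily ℂ (fun _ => H) V ∧
      ∃ v : H, ‖v‖ = 1 ∧ ∀ i u, inner ℂ v (V i u) = 0 := by
  obtain ⟨V, hV⟩ := exists_isometries hH (d + 1)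
  have : Nontrivial H := by
    by_contra h
    rw [not_nontrivial_iff_subsingleton] at h
    exact hH inferInstance
  obtain ⟨v, hv⟩ := exists_norm_eq H zero_le_one
  refine ⟨fun i => V i.castSucc, fun i j hij => hV (by simpa using hij), V (Fin.last d) v,
    by simp [hv], fun i u => hV (Fin.castSucc_lt_last i).ne' _ _⟩

variable [CompleteSpace H] [hH : Fact (¬ FiniteDimensional ℂ H)]

/-- Evaluate at `y` times the isometries and apply the result to the wandering vector. Pairing with
the degree `k` term `u k` leaves only `y ^ k * ‖u k‖ ^ 2`, and Cauchy–Schwarz gives the bound after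
division by `‖u k‖`. The strict inequality `y < x` keeps the tuple in the open ball. -/
lemma pow_mul_l2_le_ballNorm_of_lt (F : freeHol H d) (k : ℕ) {x y : ℝ} (hy : 0 ≤ y) (hyx : y < x)
    (hx : x < 1) : y ^ k * l2 F.1 k ≤ ballNorm x F := by
  obtain ⟨V, hV, v, hv, hvV⟩ := exists_isometries_wandering hH.out d
  set T : Fin d → H →L[ℂ] H := fun i => (V i).toContinuousLinearMap with hT
  have hmem := smul_isometry_mem_opBall V hV hy hyx
  have hle := norm_eval_le_ballNorm F (hy.trans hyx.le) hx hmem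
  have hs := (F.2 _ (opBall_mono (hy.trans hyx.le) hx.le hmem)).of_norm.hasSum
  set A : H →L[ℂ] H := ∑' k, evalHom F.1 k (fun i => (y : ℂ) • T i) with hA
  set u : ℕ → H := fun j => evalHom F.1 j T v with hu
  have hnu : ∀ j, ‖u j‖ = l2 F.1 j := by
    intro j
    have h := norm_sq_sum_isometry V hV j F.1.coeff v
    rw [hv, one_pow, mul_one] at h
    have h2 : u j = ∑ w ∈ words d j, F.1.coeff w • wordProd T w v := by simp [hu, evalHom]
    rw [l2, ← h, ← h2, Real.sqrt_sq (norm_nonneg _)]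
  have horth : ∀ j, j ≠ k → inner ℂ (u k) (u j) = 0 := by
    intro j hj
    simp only [hu, evalHom, sum_apply, sum_inner, inner_sum]
    refine Finset.sum_eq_zero fun w hw => Finset.sum_eq_zero fun w' hw' => ?_
    rw [smul_apply, smul_apply, inner_smul_left,
      inner_smul_right, inner_wordProd_eq_zero hV hvV, mul_zero, mul_zero]
    rw [mem_words.1 hw, mem_words.1 hw']
    exact hj.symm
  have hAv : HasSum (fun j => (y : ℂ) ^ j * inner ℂ (u k) (u j)) (inner ℂ (u k) (A v)) := by
    have h := (hs.mapL (ContinuousLinearMap.apply ℂ H v)).mapL (innerSL ℂ (u k))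
    refine h.congr_fun fun j => ?_
    rw [evalHom_smul_arg]
    exact (inner_smul_right _ _ _).symm
  have hval : inner ℂ (u k) (A v) = (y : ℂ) ^ k * inner ℂ (u k) (u k) :=
    hAv.unique (hasSum_single k fun j hj => by rw [horth j hj, mul_zero])
  have h1 : y ^ k * ‖u k‖ ^ 2 ≤ ‖u k‖ * ballNorm x F := by
    calc y ^ k * ‖u k‖ ^ 2 = ‖inner ℂ (u k) (A v)‖ := by
          rw [hval, inner_self_eq_norm_sq_to_K]
          simp [abs_of_nonneg hy]
      _ ≤ ‖u k‖ * ‖A v‖ := norm_inner_le_norm _ _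
      _ ≤ ‖u k‖ * ballNorm x F := by
          gcongr
          refine le_trans ?_ hle
          simpa [hv] using A.le_opNorm v
  rw [← hnu]
  rcases (norm_nonneg (u k)).eq_or_lt with h0 | h0
  · rw [← h0, mul_zero]
    exact ballNorm_nonneg _ _
  · refine le_of_mul_le_mul_left ?_ h0
    linarith

/-- The Cauchy estimate for the homogeneous components of a free holomorphic function. -/
lemma pow_mul_l2_le_ballNorm (F : freeHol H d) (k : ℕ) {x : ℝ} (hx : x ∈ Set.Ioo (0 : ℝ) 1) :
    x ^ k * l2 F.1 k ≤ ballNorm x F := by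
  -- The radius `x` is reached by letting `y` increase to it.
  have h : Filter.Tendsto (fun y : ℝ => y ^ k * l2 F.1 k) (nhdsWithin x (Set.Iio x))
      (nhds (x ^ k * l2 F.1 k)) :=
    (Continuous.tendsto (by fun_prop) x).mono_left nhdsWithin_le_nhds
  refine le_of_tendsto h ?_
  filter_upwards [Ioo_mem_nhdsLT hx.1] with y hy
  exact pow_mul_l2_le_ballNorm_of_lt F k hy.1.le hy.2 hx.2

end WanderingVector

/-! ### The quotient seminorm of a homogeneous class -/

section QuotNorm

variable {H : Type*} [NormedAddCommGroup H] [InnerProductSpace ℂ H] [CompleteSpace H] {d : ℕ}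

lemma bddBelow_ballNorm_image (x : ℝ) (s : Set (freeHol H d)) : BddBelow (ballNorm x '' s) :=
  ⟨0, by rintro _ ⟨F, _, rfl⟩; exact ballNorm_nonneg _ _⟩

lemma l2_ofPoly (p : Poly d) (k : ℕ) : l2 (ofPoly (H := H) p).1 k = ‖Ev d (homComp k p)‖ := by
  rw [l2, Finset.sum_congr rfl fun w _ => by rw [coeff_ofPoly], ← norm_sq_Ev_homComp,
    Real.sqrt_sq (norm_nonneg _)]

lemma homComp_homComp (k : ℕ) (p : Poly d) : homComp k (homComp k p) = homComp k p := by
  refine poly_ext fun v => ?_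
  rw [coeff_homComp, coeff_homComp]
  split_ifs <;> rfl

variable [Fact (¬ FiniteDimensional ℂ H)]

/-- Only the degree `k` term survives in the series that bounds the ball norm. -/
lemma ballNorm_ofPoly_homComp_le (p : Poly d) (k : ℕ) {x : ℝ} (hx : x ∈ Set.Ioo (0 : ℝ) 1) :
    ballNorm x (ofPoly (H := H) (homComp k p)) ≤ x ^ k * ‖Ev d (homComp k p)‖ := by
  refine (ballNorm_le_tsum _ hx.1.le hx.2).trans (le_of_eq ?_)
  rw [tsum_eq_single k, l2_ofPoly, homComp_homComp]
  intro j hj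
  rw [l2_ofPoly, show homComp j (homComp k p) = 0 from poly_ext fun v => ?_, map_zero, norm_zero,
    mul_zero]
  rw [coeff_homComp, coeff_homComp]
  split_ifs with h1 h2
  · exact absurd (h1.symm.trans h2) hj
  · rfl
  · rfl

/-- The quotient seminorm of the class of a homogeneous polynomial `p` of degree `k` is
`r ^ k * ‖p_I (Ev p)‖`. -/
lemma quotNorm_mk_ofPoly (I : GradedIdeal d) {r : ℝ} (hr : r ∈ Set.Ioo (0 : ℝ) 1) {k : ℕ}
    {p : Poly d} (hp : homComp k p = p) :
    quotNorm r (Ideal.Quotient.mk (I.closure H) (ofPoly p)) = r ^ k * ‖I.proj (Ev d p)‖ := by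
  have hrk : 0 < r ^ k := pow_pos hr.1 k
  refine le_antisymm (le_of_forall_pos_le_add fun ε hε => ?_) ?_
  · obtain ⟨q, hq, hlt⟩ := I.exists_norm_Ev_add_lt k p (div_pos hε hrk)
    -- The degree `k` part of `p + q` still represents the class, because `homComp k q` is again in
    -- `I`.
    have hmem : ofPoly (homComp k (p + q)) ∈ {F : freeHol H d |
        Ideal.Quotient.mk (I.closure H) F = Ideal.Quotient.mk (I.closure H) (ofPoly p)} := by
      refine Ideal.Quotient.eq.2 ?_
      rw [← map_sub, map_add, hp, add_sub_cancel_left]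
      exact subset_closure ⟨_, I.homComp_mem k hq, rfl⟩
    refine (csInf_le (bddBelow_ballNorm_image r _) ⟨_, hmem, rfl⟩).trans ?_
    refine (ballNorm_ofPoly_homComp_le _ k hr).trans ?_
    calc r ^ k * ‖Ev d (homComp k (p + q))‖ ≤ r ^ k * (‖I.proj (Ev d p)‖ + ε / r ^ k) := by gcongr
      _ = _ := by field_simp
  · refine le_csInf ⟨_, _, rfl, rfl⟩ ?_
    rintro _ ⟨F, hF, rfl⟩
    refine le_of_forall_pos_lt_add fun ε hε => ?_
    -- An arbitrary representative differs from `p` by an element of the closure only, so it is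
    -- approximated in `‖·‖_r` by some `p + q` with `q ∈ I`, to which the Cauchy estimate applies.
    have hG : F - ofPoly p ∈ _root_.closure (ofPoly (H := H) '' (I.toIdeal : Set (Poly d))) :=
      Ideal.Quotient.eq.1 hF
    have hnhds : {G : freeHol H d | ballNorm r (G - (F - ofPoly p)) < ε} ∈
        nhds (F - ofPoly p) := by
      have h := (withSeminorms_freeHol (H := H) (d := d)).tendsto_nhds
        (u := id) (f := nhds (F - ofPoly p)) (F - ofPoly p)
      exact h.1 Filter.tendsto_id ⟨r, hr⟩ ε hε
    obtain ⟨_, hlt, q, hq, rfl⟩ := mem_closure_iff_nhds.1 hG _ hnhds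
    have hsub : ballNorm r (ofPoly (H := H) (p + q)) ≤
        ballNorm r F + ballNorm r (ofPoly q - (F - ofPoly p)) := by
      have h := map_add_le_add (ballSeminorm (H := H) (d := d) ⟨r, hr⟩) F
        (ofPoly q - (F - ofPoly p))
      rwa [show F + (ofPoly q - (F - ofPoly p)) = ofPoly (p + q) by rw [map_add]; abel] at h
    calc r ^ k * ‖I.proj (Ev d p)‖ = r ^ k * ‖I.proj (Ev d (homComp k (p + q)))‖ := by
          rw [map_add, map_add, map_add, I.proj_Ev_of_mem (I.homComp_mem k hq), hp, add_zero]
      _ ≤ r ^ k * ‖Ev d (homComp k (p + q))‖ := by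
          gcongr
          exact I.norm_proj_apply_le _
      _ = r ^ k * l2 (ofPoly (H := H) (p + q)).1 k := by rw [l2_ofPoly]
      _ ≤ ballNorm r (ofPoly (H := H) (p + q)) := pow_mul_l2_le_ballNorm _ k hr
      _ ≤ _ := hsub
      _ < ballNorm r F + ε := by
          gcongr
          exact hlt

end QuotNorm

/-! ### Operations on continuous sections of the bundle -/

namespace LCABundle

variable {E X : Type*} [TopologicalSpace E] [TopologicalSpace X] (B : LCABundle E X)

lemma continuous_section_add {s t : ∀ x, B.Fiber x} (hs : Continuous fun x => (s x : E))
    (ht : Continuous fun x => (t x : E)) : Continuous fun x => ((s x + t x : B.Fiber x) : E) := by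
  have hst : ∀ x, B.proj (s x) = B.proj (t x) := fun x => (s x).2.trans (t x).2.symm
  refine (B.continuous_add.comp ((hs.prodMk ht).subtype_mk hst)).congr fun x => ?_
  -- The bundle adds in the fiber over `proj e'`, the sections in the fiber over `x`. With the base
  -- point a free variable `y`, the equality can be substituted away.
  have key : ∀ (y : X) (e e' : E) (h : B.proj e = y) (h' : B.proj e' = y)
      (h'' : B.proj e = B.proj e'),
      (((⟨e, h''⟩ : B.Fiber (B.proj e')) + ⟨e', rfl⟩ : B.Fiber (B.proj e')) : E) =
        ((⟨e, h⟩ + ⟨e', h'⟩ : B.Fiber y) : E) := by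
    rintro y e e' h rfl h''
    rfl
  exact key x (s x) (t x) (s x).2 (t x).2 (hst x)

lemma continuous_section_mul {s t : ∀ x, B.Fiber x} (hs : Continuous fun x => (s x : E))
    (ht : Continuous fun x => (t x : E)) : Continuous fun x => ((s x * t x : B.Fiber x) : E) := by
  have hst : ∀ x, B.proj (s x) = B.proj (t x) := fun x => (s x).2.trans (t x).2.symm
  refine (B.continuous_mul.comp ((hs.prodMk ht).subtype_mk hst)).congr fun x => ?_
  have key : ∀ (y : X) (e e' : E) (h : B.proj e = y) (h' : B.proj e' = y)
      (h'' : B.proj e = B.proj e'),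
      (((⟨e, h''⟩ : B.Fiber (B.proj e')) * ⟨e', rfl⟩ : B.Fiber (B.proj e')) : E) =
        ((⟨e, h⟩ * ⟨e', h'⟩ : B.Fiber y) : E) := by
    rintro y e e' h rfl h''
    rfl
  exact key x (s x) (t x) (s x).2 (t x).2 (hst x)

lemma continuous_section_smul (c : ℂ) {s : ∀ x, B.Fiber x} (hs : Continuous fun x => (s x : E)) :
    Continuous fun x => ((c • s x : B.Fiber x) : E) := by
  refine (B.continuous_smul.comp (hs.prodMk (continuous_const (y := c)))).congr fun x => ?_
  have key : ∀ (y : X) (e : E) (h : B.proj e = y),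
      ((c • (⟨e, rfl⟩ : B.Fiber (B.proj e)) : B.Fiber (B.proj e)) : E) =
        ((c • ⟨e, h⟩ : B.Fiber y) : E) := by
    rintro y e rfl
    rfl
  exact key x (s x) (s x).2

/-- The basic neighborhoods of a zero contain the zeros of all nearby fibers, since each `σ`
vanishes there. -/
lemma continuous_section_zero : Continuous fun x => ((0 : B.Fiber x) : E) := by
  refine continuous_iff_continuousAt.2 fun x => (B.hasBasis_nhds_zero x).tendsto_right_iff.2 ?_
  rintro ⟨U, σ, ε⟩ ⟨⟨hU, hxU⟩, hσ, hε⟩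
  filter_upwards [hU.mem_nhds hxU] with y hy
  obtain ⟨p, hp⟩ := B.isSeminorm σ hσ y
  refine ⟨?_, ?_⟩
  · rw [show B.proj ((0 : B.Fiber y) : E) = y from (0 : B.Fiber y).2]
    exact hy
  · rw [← hp, map_zero]
    exact hε

lemma continuous_section_sum {ι : Type*} (a : Finset ι) {s : ι → ∀ x, B.Fiber x}
    (hs : ∀ i ∈ a, Continuous fun x => (s i x : E)) :
    Continuous fun x => ((∑ i ∈ a, s i x : B.Fiber x) : E) := by
  classical
  induction a using Finset.induction_on with
  | empty => simpa using B.continuous_section_zero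
  | insert i a hi ih =>
    simp only [Finset.sum_insert hi]
    exact B.continuous_section_add (hs i (Finset.mem_insert_self _ _))
      (ih fun j hj => hs j (Finset.mem_insert_of_mem hj))

end LCABundle

/-! ### From continuous sections to strong continuity of the projections -/

section Continuity

variable {H : Type*} [NormedAddCommGroup H] [InnerProductSpace ℂ H] [CompleteSpace H]
  [Fact (¬ FiniteDimensional ℂ H)] {d : ℕ} {E X : Type*} [TopologicalSpace E] [TopologicalSpace X]
  {B : LCABundle E X} {I : X → GradedIdeal d} {Ψ : ∀ x, FreeHolQuot H (I x) ≃A[ℂ] B.Fiber x}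

/-- Multiply the letter sections one by one. The empty word is excluded because continuity of the
unit section is not among the bundle axioms. -/
lemma continuous_section_word (hS : ∀ i : Fin d, Continuous fun x : X =>
      (Ψ x (Ideal.Quotient.mk ((I x).closure H) (zvar i)) : E)) (w : Word d) (hw : w ≠ 1) :
    Continuous fun x : X =>
      (Ψ x (Ideal.Quotient.mk ((I x).closure H) (FreeMonoid.lift zvar w)) : E) := by
  induction w using FreeMonoid.inductionOn' with
  | one => exact absurd rfl hw
  | of_mul a w ih =>
    by_cases h : w = 1
    · simpa [h] using hS a
    · simp only [map_mul, FreeMonoid.lift_eval_of]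
      exact B.continuous_section_mul (hS a) (ih h)

lemma continuous_section_homComp (hS : ∀ i : Fin d, Continuous fun x : X =>
      (Ψ x (Ideal.Quotient.mk ((I x).closure H) (zvar i)) : E)) (p : Poly d) (k : ℕ) (hk : k ≠ 0) :
    Continuous fun x : X =>
      (Ψ x (Ideal.Quotient.mk ((I x).closure H) (ofPoly (homComp k p))) : E) := by
  have h : ofPoly (H := H) (homComp k p) =
      ∑ w ∈ words d k, p.coeff w • FreeMonoid.lift zvar w := by
    simp [homComp_apply, ofPoly]
  have h2 : ∀ x, Ψ x (Ideal.Quotient.mk ((I x).closure H) (ofPoly (homComp k p))) =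
      ∑ w ∈ words d k, p.coeff w •
        Ψ x (Ideal.Quotient.mk ((I x).closure H) (FreeMonoid.lift zvar w)) := by
    intro x
    rw [h, map_sum, map_sum]
    refine Finset.sum_congr rfl fun w _ => ?_
    exact map_smul (Ψ x) (p.coeff w)
      (Ideal.Quotient.mk ((I x).closure H) (FreeMonoid.lift zvar w))
  simp only [h2]
  refine B.continuous_section_sum _ fun w hw => B.continuous_section_smul _
    (continuous_section_word hS w ?_)
  rintro rfl
  exact hk (mem_words.1 hw).symm

lemma quotNorm_symm (r : ℝ) {x : X} {e : E} (h : B.proj e = x) :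
    quotNorm r ((Ψ (B.proj e)).symm ⟨e, rfl⟩) = quotNorm r ((Ψ x).symm ⟨e, h⟩) := by
  subst h
  rfl

lemma continuous_norm_proj_Ev (hS : ∀ i : Fin d, Continuous fun x : X =>
      (Ψ x (Ideal.Quotient.mk ((I x).closure H) (zvar i)) : E))
    {r : ℝ} (hr : r ∈ Set.Ioo (0 : ℝ) 1)
    (hσ : Continuous fun e : E => quotNorm r ((Ψ (B.proj e)).symm ⟨e, rfl⟩)) (p : Poly d) (k : ℕ) :
    Continuous fun x => ‖(I x).proj (Ev d (homComp k p))‖ := by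
  -- In degree 0 no section is needed: the vacuum is fixed by every `p_I`, so the function is
  -- constant.
  rcases eq_or_ne k 0 with rfl | hk
  · have : ∀ x, (I x).proj (Ev d (homComp 0 p)) = p.coeff 1 • fockBasis 1 := by
      intro x
      rw [homComp_apply, sum_words_zero, Ev_single, map_smul, GradedIdeal.proj_fockBasis_one]
    simp only [this]
    exact continuous_const
  · have hrk : r ^ k ≠ 0 := (pow_pos hr.1 k).ne'
    refine ((hσ.comp (continuous_section_homComp hS p k hk)).div_const (r ^ k)).congr fun x => ?_
    have h : quotNorm r ((Ψ x).symm
        (Ψ x (Ideal.Quotient.mk ((I x).closure H) (ofPoly (homComp k p))))) =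
        r ^ k * ‖(I x).proj (Ev d (homComp k p))‖ := by
      rw [ContinuousAlgEquiv.symm_apply_apply, quotNorm_mk_ofPoly (I x) hr (homComp_homComp k p)]
    have h' := (quotNorm_symm (Ψ := Ψ) r
      (Ψ x (Ideal.Quotient.mk ((I x).closure H) (ofPoly (homComp k p)))).2).trans h
    rw [← mul_div_cancel_left₀ ‖(I x).proj (Ev d (homComp k p))‖ hrk, ← h']
    rfl

/-- Since `p_I` is a self-adjoint idempotent, its quadratic form is `‖p_I f‖ ^ 2`, and polarization
recovers the real part of `⟪p_I f, g⟫`. With `g` the value at a base point, this controls the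
distance from `p_I f` to `g`. -/
lemma continuous_proj_apply {I : X → GradedIdeal d}
    (h : ∀ (p : Poly d) (k : ℕ), Continuous fun x => ‖(I x).proj (Ev d (homComp k p))‖)
    (f : Fock d) : Continuous fun x => (I x).proj f := by
  have hb : ∀ w : Word d, Continuous fun x => (I x).proj (fockBasis w) := by
    intro w
    set k := w.toList.length
    have hdeg : ∀ g : Fock d, ∃ p : Poly d, degProj d k g = Ev d (homComp k p) := fun g => by
      obtain ⟨p, hp, hg⟩ := degProj_mem_range k g
      exact ⟨p, hg.trans (by rw [hp])⟩
    have hD : ∀ g : Fock d, Continuous fun x => ‖(I x).proj (degProj d k g)‖ := fun g => by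
      obtain ⟨p, hp⟩ := hdeg g
      rw [hp]
      exact h p k
    have hw : degProj d k (fockBasis w) = fockBasis w := by
      classical
      rw [degProj_apply, Finset.sum_eq_single w]
      · rw [fockBasis_apply, if_pos rfl, one_smul]
      · intro v _ hv
        rw [fockBasis_apply, if_neg hv, zero_smul]
      · intro hw
        exact absurd (mem_words.2 rfl) hw
    refine continuous_iff_continuousAt.2 fun y => ?_
    -- The comparison vector is frozen at the base point `y`. It stays in degree `k` because `p_I`
    -- commutes with `degProj`, so the hypothesis covers `fockBasis w ± g`.
    set g := (I y).proj (fockBasis w) with hg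
    have hgD : degProj d k g = g := by rw [hg, ← GradedIdeal.proj_degProj, hw]
    -- Expand the square and replace the cross term by real polarization, using `⟪p f, p g⟫ = ⟪p f,
    -- g⟫`.
    have hre : ∀ x, ‖(I x).proj (fockBasis w) - g‖ ^ 2 =
        ‖(I x).proj (degProj d k (fockBasis w))‖ ^ 2 -
          2 * ((‖(I x).proj (degProj d k (fockBasis w + g))‖ ^ 2 -
            ‖(I x).proj (degProj d k (fockBasis w - g))‖ ^ 2) / 4) + ‖g‖ ^ 2 := by
      intro x
      have h1 := norm_add_sq (𝕜 := ℂ) ((I x).proj (fockBasis w)) ((I x).proj g)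
      have h2 := norm_sub_sq (𝕜 := ℂ) ((I x).proj (fockBasis w)) ((I x).proj g)
      rw [GradedIdeal.inner_proj_proj] at h1 h2
      rw [norm_sub_sq (𝕜 := ℂ), map_add, map_sub, map_add, map_sub, hw, hgD, h1, h2]
      ring
    have hcont : Continuous fun x => ‖(I x).proj (fockBasis w) - g‖ ^ 2 := by
      simp only [hre]
      exact (((hD _).pow 2).sub (((((hD _).pow 2).sub ((hD _).pow 2)).div_const 4).const_mul 2)).add
        continuous_const
    have ht := (hcont.tendsto y).sqrt
    simp only [Real.sqrt_sq (norm_nonneg _)] at ht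
    rw [← hg, sub_self, norm_zero] at ht
    exact tendsto_iff_norm_sub_tendsto_zero.2 ht
  have hspan : ∀ g ∈ Submodule.span ℂ (Set.range (fockBasis (d := d))),
      Continuous fun x => (I x).proj g := by
    intro g hg
    induction hg using Submodule.span_induction with
    | mem g hg =>
      obtain ⟨w, rfl⟩ := hg
      exact hb w
    | zero => simpa using continuous_const
    | add g g' _ _ hg hg' => exact (hg.add hg').congr fun x => (map_add _ _ _).symm
    | smul c g _ hg => exact (hg.const_smul c).congr fun x => (map_smul ((I x).proj) c g).symm
  -- All the projections are contractions, so approximating `f` by a finite combination `g` of basis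
  -- vectors is uniform in `x`.
  refine continuous_of_uniform_approx_of_continuous fun u hu => ?_
  obtain ⟨ε, hε, hu⟩ := Metric.mem_uniformity_dist.1 hu
  obtain ⟨g, hg, hlt⟩ := Metric.mem_closure_iff.1 (dense_span_fockBasis f) ε hε
  refine ⟨_, hspan g hg, fun x => hu ?_⟩
  rw [dist_eq_norm] at hlt ⊢
  rw [← map_sub]
  exact ((I x).norm_proj_apply_le _).trans_lt hlt

end Continuity

end FreeHol

theorem mainTheorem5
    {H : Type*} [NormedAddCommGroup H] [InnerProductSpace ℂ H] [CompleteSpace H]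
    [Fact (¬ FiniteDimensional ℂ H)] {d : ℕ}
    {E X : Type*} [TopologicalSpace E] [TopologicalSpace X] (B : FreeHol.LCABundle E X)
    (I : X → FreeHol.GradedIdeal d)
    (Ψ : ∀ x, FreeHol.FreeHolQuot H (I x) ≃A[ℂ] B.Fiber x)
    (hS : ∀ i : Fin d, Continuous fun x : X =>
      (Ψ x (Ideal.Quotient.mk ((I x).closure H) (FreeHol.zvar i)) : E))
    (r : ℝ) (hr : r ∈ Set.Ioo (0 : ℝ) 1)
    (hσ : Continuous fun e : E => FreeHol.quotNorm r ((Ψ (B.proj e)).symm ⟨e, rfl⟩)) :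
    Continuous fun x : X => (I x).toProjSpace := by
  refine Continuous.subtype_mk
    (PointwiseConvergenceCLM.continuous_of_continuous_eval fun f => ?_) _
  exact FreeHol.continuous_proj_apply (FreeHol.continuous_norm_proj_Ev hS hr hσ) f
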